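/- Let $\mathbb{T}$ be the set of isomorphism classes of finite rooted trees, and let $|t|$ be the number of vertices of $t\in\mathbb{T}$. For trees $s,t$ and a vertex $v$ of $t$, let $t\cup_v s$ be the rooted tree obtained by joining the root of $s$ to $v$ by a new edge. For an edge $e$ of $t$, let $R_e(t)$ and $P_e(t)$ be the components of $t$ with $e$ removed that do, respectively do not, contain the root of $t$; $P_e(t)$ is rooted at its endpoint of $e$. Put $$\alpha(t_1,t_2,t_3)=\#\{e\in E(t_2) : R_e(t_2)=t_3,\ P_e(t_2)=t_1\},\qquad \beta(t_1,t_2,t_3)=\#\{v\in V(t_3) : t_1=t_3\cup_v t_2\}.$$ The insertion-elimination algebra $\mathfrak{g}$ is the complex Lie algebra with basis $\{d\}\cup\{D_t^+,D_t^- : t\in\mathbb{T}\}$ and brackets $$[D_s^+,D_t^+]=\sum_{r\in\mathbb{T}}\bigl(\beta(r,s,t)-\beta(r,t,s)\bigr)D_r^+,\qquad [D_s^-,D_t^-]=\sum_{r\in\mathbb{T}}\bigl(\alpha(t,r,s)-\alpha(s,r,t)\bigr)D_r^-,$$ $$[D_s^-,D_t^+]=\sum_{r\in\mathbb{T}}\alpha(s,t,r)D_r^+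 +\sum_{r\in\mathbb{T}}\beta(s,t,r)D_r^-\quad (s\neq t),\qquad [D_t^-,D_t^+]=d,$$ $$[d,D_t^+]=|t|D_t^+,\qquad [d,D_t^-]=-|t|D_t^-.$$ Let $\mathfrak{n}^+$ be the Lie subalgebra spanned by the $D_t^+$, $t\in\mathbb{T}$, and let $\eta:\mathfrak{n}^+\to\mathbb{C}$ be a Lie algebra homomorphism. Let $\mathbb{C}_\eta$ be the one-dimensional $\mathfrak{n}^+$-module on which $x\in\mathfrak{n}^+$ acts as $\eta(x)$, and let $M_\eta=U(\mathfrak{g})\otimes_{U(\mathfrak{n}^+)}\mathbb{C}_\eta$ be the standard Whittaker module. A Whittaker vector (of type $\eta$) in $M_\eta$ is a vector $w\in M_\eta$ with $xw=\eta(x)w$ for all $x\in\mathfrak{n}^+$. The homomorphism $\eta$ has finite support if there is a positive integer $M$ with $\eta(D_t^+)=0$ whenever $|t|\ge M$. **Corollary.** If $\eta:\mathfrak{n}^+\to\mathbb{C}$ is nonzero and has finite support, then $M_\eta$ is a simple $\mathfrak{g}$-module and its space of Whittaker vectors is one-dimensional. -/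

import Mathlib

noncomputable section

namespace InsElim

/-! ### Rooted trees -/

/-- Finite rooted trees with an ordering of the branches at every vertex: `pt` is the one-vertex
tree, and `join s t` is obtained from `t` by attaching `s` to the root of `t` along a new edge
(as the first branch).  Every finite ordered rooted tree is so obtained in exactly one way. -/
inductive OTree : Type
  | pt : OTree
  | join : OTree → OTree → OTree

namespace OTree

/-- Two ordered rooted trees are isomorphic as rooted trees iff one is obtained from the other by
reordering branches, i.e. by finitely many exchanges of neighbouring branches at vertices. -/
inductive Iso : OTree → OTree → Prop
  | refl (t) : Iso t t
  | symm {s t} : Iso s t → Iso t s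
  | trans {r s t} : Iso r s → Iso s t → Iso r t
  | congr {s s' t t'} : Iso s s' → Iso t t' → Iso (join s t) (join s' t')
  | swap (r s t) : Iso (join r (join s t)) (join s (join r t))

instance setoid : Setoid OTree := ⟨Iso, Iso.refl, Iso.symm, Iso.trans⟩

/-- The vertices of a tree. -/
def Vert : OTree → Type
  | pt => Unit
  | join s t => Vert s ⊕ Vert t

/-- The edges of a tree: those of `join s t` are the new edge (joining the root of `s` to the root
of `t`), the edges of `s`, and the edges of `t`. -/
def Edge : OTree → Type
  | pt => Empty
  | join s t => Unit ⊕ (Edge s ⊕ Edge t)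

/-- `attach t v u` is the tree `t ∪_v u`: the root of `u` is joined to the vertex `v` of `t` by a
new edge. -/
def attach : (t : OTree) → Vert t → OTree → OTree
  | pt, _, u => join u pt
  | join s t, Sum.inl v, u => join (attach s v u) t
  | join s t, Sum.inr v, u => join s (attach t v u)

/-- `rootPart t e` is `R_e(t)`: the component containing the root after removal of the edge `e`. -/
def rootPart : (t : OTree) → Edge t → OTree
  | join _ t, Sum.inl _ => t
  | join s t, Sum.inr (Sum.inl e) => join (rootPart s e) t
  | join s t, Sum.inr (Sum.inr e) => join s (rootPart t e)

/-- `branchPart t e` is `P_e(t)`: the component not containing the root after removal of the edge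
`e`, rooted at the endpoint of `e` that it contains. -/
def branchPart : (t : OTree) → Edge t → OTree
  | join s _, Sum.inl _ => s
  | join s _, Sum.inr (Sum.inl e) => branchPart s e
  | join _ t, Sum.inr (Sum.inr e) => branchPart t e

instance fintypeVert : (t : OTree) → Fintype (Vert t)
  | pt => inferInstanceAs (Fintype Unit)
  | join s t =>
    letI := fintypeVert s
    letI := fintypeVert t
    inferInstanceAs (Fintype (Vert s ⊕ Vert t))

instance fintypeEdge : (t : OTree) → Fintype (Edge t)
  | pt => inferInstanceAs (Fintype Empty)
  | join s t =>
    letI := fintypeEdge s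
    letI := fintypeEdge t
    inferInstanceAs (Fintype (Unit ⊕ (Edge s ⊕ Edge t)))

theorem attach_congr (t : OTree) (v : Vert t) {u u' : OTree} (h : Iso u u') :
    Iso (attach t v u) (attach t v u') := by
  induction t with
  | pt => exact Iso.congr h (Iso.refl _)
  | join s t hs ht =>
    rcases v with v | v
    · exact Iso.congr (hs v) (Iso.refl _)
    · exact Iso.congr (Iso.refl _) (ht v)

theorem exists_vertEquiv {s t : OTree} (h : Iso s t) :
    ∃ f : Vert s ≃ Vert t, ∀ v u, Iso (attach s v u) (attach t (f v) u) := by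
  induction h with
  | refl t => exact ⟨Equiv.refl _, fun v u => Iso.refl _⟩
  | symm _ ih =>
    obtain ⟨f, hf⟩ := ih
    refine ⟨f.symm, fun v u => Iso.symm ?_⟩
    simpa using hf (f.symm v) u
  | trans _ _ ih₁ ih₂ =>
    obtain ⟨f, hf⟩ := ih₁
    obtain ⟨g, hg⟩ := ih₂
    exact ⟨f.trans g, fun v u => Iso.trans (hf v u) (hg _ u)⟩
  | congr h₁ h₂ ih₁ ih₂ =>
    obtain ⟨f, hf⟩ := ih₁
    obtain ⟨g, hg⟩ := ih₂
    refine ⟨Equiv.sumCongr f g, fun v u => ?_⟩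
    rcases v with v | v
    · exact Iso.congr (hf v u) h₂
    · exact Iso.congr h₁ (hg v u)
  | swap r s t =>
    refine ⟨(Equiv.sumAssoc (Vert r) (Vert s) (Vert t)).symm.trans
      ((Equiv.sumCongr (Equiv.sumComm _ _) (Equiv.refl _)).trans (Equiv.sumAssoc _ _ _)), ?_⟩
    rintro (v | v | v) u
    · exact Iso.swap _ _ _
    · exact Iso.swap _ _ _
    · exact Iso.swap _ _ _

theorem exists_edgeEquiv {s t : OTree} (h : Iso s t) :
    ∃ f : Edge s ≃ Edge t, ∀ e, Iso (rootPart s e) (rootPart t (f e)) ∧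
      Iso (branchPart s e) (branchPart t (f e)) := by
  induction h with
  | refl t => exact ⟨Equiv.refl _, fun e => ⟨Iso.refl _, Iso.refl _⟩⟩
  | symm _ ih =>
    obtain ⟨f, hf⟩ := ih
    refine ⟨f.symm, fun e => ?_⟩
    have := hf (f.symm e)
    rw [Equiv.apply_symm_apply] at this
    exact ⟨this.1.symm, this.2.symm⟩
  | trans _ _ ih₁ ih₂ =>
    obtain ⟨f, hf⟩ := ih₁
    obtain ⟨g, hg⟩ := ih₂
    exact ⟨f.trans g, fun e =>
      ⟨(hf e).1.trans (hg _).1, (hf e).2.trans (hg _).2⟩⟩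
  | congr h₁ h₂ ih₁ ih₂ =>
    obtain ⟨f, hf⟩ := ih₁
    obtain ⟨g, hg⟩ := ih₂
    refine ⟨Equiv.sumCongr (Equiv.refl _) (Equiv.sumCongr f g), fun e => ?_⟩
    rcases e with e | e | e
    · exact ⟨h₂, h₁⟩
    · exact ⟨Iso.congr (hf e).1 h₂, (hf e).2⟩
    · exact ⟨Iso.congr h₁ (hg e).1, (hg e).2⟩
  | swap r s t =>
    let F : ∀ r s t : OTree, Edge (join r (join s t)) → Edge (join s (join r t)) :=
      fun r s t e => match e with
      | Sum.inl _ => Sum.inr (Sum.inr (Sum.inl ()))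
      | Sum.inr (Sum.inl e) => Sum.inr (Sum.inr (Sum.inr (Sum.inl e)))
      | Sum.inr (Sum.inr (Sum.inl _)) => Sum.inl ()
      | Sum.inr (Sum.inr (Sum.inr (Sum.inl e))) => Sum.inr (Sum.inl e)
      | Sum.inr (Sum.inr (Sum.inr (Sum.inr e))) => Sum.inr (Sum.inr (Sum.inr (Sum.inr e)))
    have hF : ∀ r s t e, F s r t (F r s t e) = e := by
      rintro r s t (e | e | e | e | e) <;> rfl
    refine ⟨⟨F r s t, F s r t, hF r s t, hF s r t⟩, ?_⟩
    rintro (e | e | e | e | e)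
    · exact ⟨Iso.refl _, Iso.refl _⟩
    · exact ⟨Iso.swap _ _ _, Iso.refl _⟩
    · exact ⟨Iso.refl _, Iso.refl _⟩
    · exact ⟨Iso.swap _ _ _, Iso.refl _⟩
    · exact ⟨Iso.swap _ _ _, Iso.refl _⟩

end OTree

open OTree

/-- The set `𝕋` of (isomorphism classes of finite) rooted trees. -/
def RTree : Type := Quotient OTree.setoid

namespace RTree

/-- The isomorphism class of an ordered rooted tree. -/
def mk (t : OTree) : RTree := Quotient.mk _ t

theorem mk_eq {s t : OTree} : mk s = mk t ↔ Iso s t := Quotient.eq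

theorem ind {p : RTree → Prop} (h : ∀ t, p (mk t)) (t : RTree) : p t := Quotient.ind h t

/-- The number of vertices `|t|` of a rooted tree `t`. -/
def size (t : RTree) : ℕ :=
  Quotient.liftOn t (fun t => Nat.card (Vert t)) fun _ _ h => by
    obtain ⟨f, -⟩ := exists_vertEquiv h
    exact Nat.card_congr f

/-- `α(t₁, t₂, t₃)` is the number of edges `e` of `t₂` with `R_e(t₂) = t₃` and `P_e(t₂) = t₁`. -/
def alpha (t₁ t₂ t₃ : RTree) : ℕ :=
  Quotient.liftOn t₂
    (fun t => Nat.card {e : Edge t // mk (rootPart t e) = t₃ ∧ mk (branchPart t e) = t₁})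
    fun s t h => by
      obtain ⟨f, hf⟩ := exists_edgeEquiv h
      refine Nat.card_congr (f.subtypeEquiv fun e => ?_)
      rw [mk_eq.2 (hf e).1, mk_eq.2 (hf e).2]

/-- `β(t₁, t₂, t₃)` is the number of vertices `v` of `t₃` with `t₁ = t₃ ∪_v t₂`. -/
def beta (t₁ t₂ t₃ : RTree) : ℕ :=
  Quotient.liftOn₂ t₂ t₃ (fun u t => Nat.card {v : Vert t // t₁ = mk (attach t v u)})
    fun u t u' t' hu ht => by
      obtain ⟨f, hf⟩ := exists_vertEquiv ht
      refine Nat.card_congr (f.subtypeEquiv fun v => ?_)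
      rw [mk_eq.2 ((attach_congr t v hu).trans (hf v u'))]

end RTree

open RTree

/-! ### The insertion-elimination Lie algebra: basis and structure constants -/

/-- The index set of the basis `{d} ∪ {D_t^+, D_t^- ∣ t ∈ 𝕋}`. -/
inductive Gen : Type
  | d : Gen
  | plus : RTree → Gen
  | minus : RTree → Gen

/-- The complex vector space with basis `{d} ∪ {D_t^+, D_t^- ∣ t ∈ 𝕋}`. -/
def InsElimAlg : Type := Gen →₀ ℂ

instance : AddCommGroup InsElimAlg := inferInstanceAs (AddCommGroup (Gen →₀ ℂ))

instance : Module ℂ InsElimAlg := inferInstanceAs (Module ℂ (Gen →₀ ℂ))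

/-- The defining basis of the insertion-elimination algebra. -/
def genBasis : Module.Basis Gen ℂ InsElimAlg := Finsupp.basisSingleOne

/-- The basis element `d`. -/
def dElt : InsElimAlg := genBasis Gen.d

/-- The basis element `D_t^+`. -/
def Dplus (t : RTree) : InsElimAlg := genBasis (Gen.plus t)

/-- The basis element `D_t^-`. -/
def Dminus (t : RTree) : InsElimAlg := genBasis (Gen.minus t)

/-- The value of `[D_s^-, D_t^+]`.  (The two sums vanish when `s = t`, and all sums over `𝕋` have
only finitely many nonzero terms.) -/
def minusPlus (s t : RTree) : InsElimAlg :=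
  open Classical in
  (if s = t then dElt else 0) +
    ((∑ᶠ r, (alpha s t r : ℂ) • Dplus r) + ∑ᶠ r, (beta s t r : ℂ) • Dminus r)

/-- The bracket of two basis elements. -/
def genBracket : Gen → Gen → InsElimAlg
  | Gen.d, Gen.d => 0
  | Gen.d, Gen.plus t => (size t : ℂ) • Dplus t
  | Gen.d, Gen.minus t => -(size t : ℂ) • Dminus t
  | Gen.plus t, Gen.d => -(size t : ℂ) • Dplus t
  | Gen.minus t, Gen.d => (size t : ℂ) • Dminus t
  | Gen.plus s, Gen.plus t => ∑ᶠ r, ((beta r s t : ℂ) - (beta r t s : ℂ)) • Dplus r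
  | Gen.minus s, Gen.minus t => ∑ᶠ r, ((alpha t r s : ℂ) - (alpha s r t : ℂ)) • Dminus r
  | Gen.minus s, Gen.plus t => minusPlus s t
  | Gen.plus s, Gen.minus t => -minusPlus t s

/-- The bilinear extension of `genBracket`. -/
def bracketMap : InsElimAlg →ₗ[ℂ] InsElimAlg →ₗ[ℂ] InsElimAlg :=
  genBasis.constr ℂ fun x => genBasis.constr ℂ fun y => genBracket x y

/-! ### The Jacobi identity

The Jacobi identity is proved by letting the algebra act faithfully on the space `TreeSp` with
basis `𝕋`. -/

namespace RTree

/-- The tree obtained from `t` by attaching `s` to its root. -/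
def joinT (s t : RTree) : RTree :=
  Quotient.liftOn₂ s t (fun s t => mk (join s t)) fun _ _ _ _ h₁ h₂ =>
    mk_eq.2 (Iso.congr h₁ h₂)

/-- The one-vertex tree. -/
def ptT : RTree := mk pt

theorem joinT_swap (r s t : RTree) : joinT r (joinT s t) = joinT s (joinT r t) := by
  induction r using RTree.ind
  induction s using RTree.ind
  induction t using RTree.ind
  exact mk_eq.2 (Iso.swap _ _ _)

theorem rec_joinT {p : RTree → Prop} (h₀ : p ptT) (h : ∀ s t, p s → p t → p (joinT s t))
    (t : RTree) : p t := by
  induction t using RTree.ind with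
  | h t =>
    induction t with
    | pt => exact h₀
    | join s t hs ht => exact h _ _ hs ht

/-- The multiset of branches at the root of an ordered tree. -/
def branches : OTree → Multiset RTree
  | pt => 0
  | join s t => mk s ::ₘ branches t

/-- The multiset of components of a rooted tree. -/
def components (t : RTree) : Multiset RTree :=
  Quotient.liftOn t branches fun s t h => by
    change Iso s t at h
    induction h with
    | refl => rfl
    | symm _ ih => exact ih.symm
    | trans _ _ ih₁ ih₂ => exact ih₁.trans ih₂
    | congr h₁ h₂ ih₁ ih₂ => simp only [branches, ih₂, mk_eq.2 h₁]
    | swap r s t => exact Multiset.cons_swap _ _ _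

theorem components_ptT : components ptT = 0 := rfl

theorem components_joinT (s t : RTree) : components (joinT s t) = s ::ₘ components t := by
  induction s using RTree.ind
  induction t using RTree.ind
  rfl

theorem joinT_ne_ptT (s t : RTree) : joinT s t ≠ ptT := fun h => by
  have := congrArg components h
  rw [components_joinT, components_ptT] at this
  exact Multiset.cons_ne_zero this

theorem joinT_ptT_inj {s t : RTree} (h : joinT s ptT = joinT t ptT) : s = t := by
  have := congrArg components h
  rw [components_joinT, components_joinT] at this
  exact (Multiset.cons_inj_left _).1 this

theorem size_ptT : size ptT = 1 := by
  change Nat.card Unit = 1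
  simp

theorem size_joinT (s t : RTree) : size (joinT s t) = size s + size t := by
  induction s using RTree.ind with | h s =>
  induction t using RTree.ind with | h t =>
  change Nat.card (Vert s ⊕ Vert t) = Nat.card (Vert s) + Nat.card (Vert t)
  exact Nat.card_sum

end RTree

/-- The complex vector space with basis the set of rooted trees. -/
abbrev TreeSp : Type := RTree →₀ ℂ

open Finsupp

/-- The sum of all `t ∪_v u` over the vertices `v` of `t`. -/
def graft (u t : RTree) : TreeSp :=
  Quotient.liftOn₂ u t (fun u t => ∑ v : Vert t, single (mk (attach t v u)) 1)
    fun u t u' t' hu ht => by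
      obtain ⟨f, hf⟩ := exists_vertEquiv ht
      refine Fintype.sum_equiv f _ _ fun v => ?_
      rw [mk_eq.2 ((attach_congr t v hu).trans (hf v u'))]

open Classical in
/-- The sum of all `R_e(t)` over the edges `e` of `t` with `P_e(t) = s`. -/
def prune (s t : RTree) : TreeSp :=
  Quotient.liftOn t
    (fun t => ∑ e : Edge t, if mk (branchPart t e) = s then single (mk (rootPart t e)) 1 else 0)
    fun t t' h => by
      obtain ⟨f, hf⟩ := exists_edgeEquiv h
      refine Fintype.sum_equiv f _ _ fun e => ?_
      rw [mk_eq.2 (hf e).1, mk_eq.2 (hf e).2]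

theorem graft_apply (u t r : RTree) : graft u t r = beta r u t := by
  classical
  induction u using RTree.ind with | h u =>
  induction t using RTree.ind with | h t =>
  change (∑ v : Vert t, single (mk (attach t v u)) (1 : ℂ)) r
    = (Nat.card {v : Vert t // r = mk (attach t v u)} : ℂ)
  rw [Nat.card_eq_fintype_card, Fintype.card_subtype, Finsupp.finsetSum_apply]
  simp only [Finsupp.single_apply, Finset.sum_boole, eq_comm]

theorem prune_apply (s t r : RTree) : prune s t r = alpha s t r := by
  classical
  induction t using RTree.ind with | h t =>
  change (∑ e : Edge t, if mk (branchPart t e) = s then single (mk (rootPart t e)) (1 : ℂ)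
    else 0) r = (Nat.card {e : Edge t // mk (rootPart t e) = r ∧ mk (branchPart t e) = s} : ℂ)
  rw [Nat.card_eq_fintype_card, Fintype.card_subtype, Finsupp.finsetSum_apply,
    ← Finset.sum_boole]
  refine Finset.sum_congr rfl fun e _ => ?_
  by_cases h₁ : mk (branchPart t e) = s <;> by_cases h₂ : mk (rootPart t e) = r <;>
    simp [h₁, h₂]

theorem OTree.exists_edge_attach (t : OTree) (v : Vert t) (u : OTree) :
    ∃ e : Edge (attach t v u), rootPart _ e = t ∧ branchPart _ e = u := by
  induction t with
  | pt => exact ⟨Sum.inl (), rfl, rfl⟩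
  | join s t hs ht =>
    rcases v with v | v
    · obtain ⟨e, h₁, h₂⟩ := hs v
      exact ⟨Sum.inr (Sum.inl e), congrArg (fun x => join x t) h₁, h₂⟩
    · obtain ⟨e, h₁, h₂⟩ := ht v
      exact ⟨Sum.inr (Sum.inr e), congrArg (join s) h₁, h₂⟩

theorem OTree.exists_vert_edge (t : OTree) (e : Edge t) :
    ∃ v : Vert (rootPart t e), Iso (attach (rootPart t e) v (branchPart t e)) t := by
  have root : ∀ s t : OTree, ∃ v : Vert t, Iso (attach t v s) (join s t) := by
    intro s t
    induction t with
    | pt => exact ⟨(), Iso.refl _⟩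
    | join a b _ hb =>
      obtain ⟨v, hv⟩ := hb
      exact ⟨Sum.inr v, (Iso.congr (Iso.refl a) hv).trans (Iso.swap _ _ _)⟩
  induction t with
  | pt => exact e.elim
  | join s t hs ht =>
    rcases e with e | e | e
    · exact root s t
    · obtain ⟨v, hv⟩ := hs e
      exact ⟨Sum.inl v, Iso.congr hv (Iso.refl _)⟩
    · obtain ⟨v, hv⟩ := ht e
      exact ⟨Sum.inr v, Iso.congr (Iso.refl _) hv⟩

theorem finite_alpha (t s : RTree) : {r | alpha t r s ≠ 0}.Finite := by
  induction t using RTree.ind with | h t =>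
  induction s using RTree.ind with | h s =>
  refine (Set.finite_range fun v : Vert s => mk (attach s v t)).subset fun r hr => ?_
  induction r using RTree.ind with | h r =>
  have hr' : Nat.card {e : Edge r // mk (rootPart r e) = mk s ∧ mk (branchPart r e) = mk t} ≠ 0 :=
    hr
  obtain ⟨⟨e, h₁, h₂⟩⟩ := (Nat.card_ne_zero.1 hr').1
  obtain ⟨v, hv⟩ := r.exists_vert_edge e
  obtain ⟨f, hf⟩ := exists_vertEquiv (mk_eq.1 h₁)
  refine ⟨f v, mk_eq.2 (Iso.trans (Iso.symm ?_) hv)⟩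
  exact (attach_congr _ v (mk_eq.1 h₂)).trans (hf v t)

theorem finite_beta (s t : RTree) : {r | beta s t r ≠ 0}.Finite := by
  induction t using RTree.ind with | h t =>
  induction s using RTree.ind with | h s =>
  refine (Set.finite_range fun e : Edge s => mk (rootPart s e)).subset fun r hr => ?_
  induction r using RTree.ind with | h r =>
  have hr' : Nat.card {v : Vert r // mk s = mk (attach r v t)} ≠ 0 := hr
  obtain ⟨⟨v, h⟩⟩ := (Nat.card_ne_zero.1 hr').1
  obtain ⟨e, h₁, -⟩ := r.exists_edge_attach v t
  obtain ⟨f, hf⟩ := exists_edgeEquiv (mk_eq.1 h.symm)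
  refine ⟨f e, ?_⟩
  change mk (rootPart s (f e)) = mk r
  rw [← mk_eq.2 (hf e).1, h₁]

/-- The vector with coefficients `r ↦ α(t, r, s)`. -/
def pruneDual (t s : RTree) : TreeSp :=
  Finsupp.ofSupportFinite (fun r => (alpha t r s : ℂ))
    ((finite_alpha t s).subset fun r hr => by simpa using hr)

/-- The vector with coefficients `r ↦ β(s, t, r)`. -/
def graftDual (s t : RTree) : TreeSp :=
  Finsupp.ofSupportFinite (fun r => (beta s t r : ℂ))
    ((finite_beta s t).subset fun r hr => by simpa using hr)

theorem pruneDual_apply (t s r : RTree) : pruneDual t s r = alpha t r s := rfl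

theorem graftDual_apply (s t r : RTree) : graftDual s t r = beta s t r := rfl

/-- The bilinear extension of `joinT`. -/
def joinL : TreeSp →ₗ[ℂ] TreeSp →ₗ[ℂ] TreeSp :=
  linearCombination ℂ fun a => linearCombination ℂ fun b => single (joinT a b) 1

theorem joinL_single (a b : RTree) :
    joinL (single a 1) (single b 1) = single (joinT a b) 1 := by
  simp [joinL]

theorem joinL_swap (x y z : TreeSp) : joinL x (joinL y z) = joinL y (joinL x z) := by
  induction x using Finsupp.induction_linear with
  | zero => simp
  | add x x' h h' => simp only [map_add, LinearMap.add_apply, h, h']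
  | single a c =>
  induction y using Finsupp.induction_linear with
  | zero => simp
  | add x x' h h' => simp only [map_add, LinearMap.add_apply, h, h']
  | single b c' =>
  induction z using Finsupp.induction_linear with
  | zero => simp
  | add x x' h h' => simp only [map_add, h, h']
  | single r c'' =>
    have e : ∀ (t : RTree) (c : ℂ), single t c = c • single t (1 : ℂ) := by simp
    rw [e a, e b, e r]
    simp only [map_smul, LinearMap.smul_apply, joinL_single, joinT_swap a b r]
    simp only [smul_smul]
    congr 1
    ring

theorem graft_ptT (u : RTree) : graft u ptT = single (joinT u ptT) 1 := by
  induction u using RTree.ind with | h u =>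
  change ∑ v : Unit, single (mk (join u pt)) (1 : ℂ) = _
  simp
  rfl

theorem graft_joinT (u s t : RTree) :
    graft u (joinT s t) = joinL (graft u s) (single t 1) + joinL (single s 1) (graft u t) := by
  induction u using RTree.ind with | h u =>
  induction s using RTree.ind with | h s =>
  induction t using RTree.ind with | h t =>
  change ∑ v : Vert s ⊕ Vert t, single (mk (attach (join s t) v u)) (1 : ℂ) =
    joinL (∑ v : Vert s, single (mk (attach s v u)) 1) (single (mk t) 1) +
      joinL (single (mk s) 1) (∑ v : Vert t, single (mk (attach t v u)) 1)
  rw [Fintype.sum_sum_type]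
  simp only [map_sum, LinearMap.sum_apply, joinL_single]
  rfl

theorem prune_ptT (s : RTree) : prune s ptT = 0 := by
  change ∑ e : Empty, _ = _
  simp

open Classical in
theorem prune_joinT (u s t : RTree) :
    prune u (joinT s t) = (if s = u then single t 1 else 0) +
      (joinL (prune u s) (single t 1) + joinL (single s 1) (prune u t)) := by
  induction s using RTree.ind with | h s =>
  induction t using RTree.ind with | h t =>
  change ∑ e : Unit ⊕ (Edge s ⊕ Edge t), (if mk (branchPart (join s t) e) = u then
      single (mk (rootPart (join s t) e)) (1 : ℂ) else 0) =
    (if mk s = u then single (mk t) 1 else 0) +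
    (joinL (∑ e : Edge s, if mk (branchPart s e) = u then single (mk (rootPart s e)) 1 else 0)
      (single (mk t) 1) + joinL (single (mk s) 1)
      (∑ e : Edge t, if mk (branchPart t e) = u then single (mk (rootPart t e)) 1 else 0))
  rw [Fintype.sum_sum_type, Fintype.sum_sum_type]
  simp only [map_sum, LinearMap.sum_apply, apply_ite joinL, apply_ite (joinL (single (mk s) 1)),
    map_zero]
  congr 1
  · simp
    rfl
  · congr 1
    · refine Finset.sum_congr rfl fun e _ => ?_
      change (if mk (branchPart s e) = u then single (mk (join (rootPart s e) t)) (1 : ℂ) else 0) = _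
      split_ifs
      · rw [joinL_single]; rfl
      · simp
    · refine Finset.sum_congr rfl fun e _ => ?_
      change (if mk (branchPart t e) = u then single (mk (join s (rootPart t e))) (1 : ℂ) else 0) = _
      split_ifs
      · rw [joinL_single]; rfl
      · simp

/-- The operator of grafting, linear in the grafted tree. -/
def graftL : TreeSp →ₗ[ℂ] Module.End ℂ TreeSp :=
  linearCombination ℂ fun u => linearCombination ℂ fun t => graft u t

/-- The operator of pruning, linear in the pruned tree. -/
def pruneL : TreeSp →ₗ[ℂ] Module.End ℂ TreeSp :=
  linearCombination ℂ fun u => linearCombination ℂ fun t => prune u t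

/-- The operator multiplying each tree by its number of vertices. -/
def sizeL : Module.End ℂ TreeSp := linearCombination ℂ fun t => (size t : ℂ) • single t 1

/-- The bilinear form for which the trees are orthonormal. -/
def pair : TreeSp →ₗ[ℂ] TreeSp →ₗ[ℂ] ℂ :=
  linearCombination ℂ fun u => Finsupp.lapply u

theorem graftL_pt (x : TreeSp) : graftL x (single ptT 1) = joinL x (single ptT 1) := by
  induction x using Finsupp.induction_linear with
  | zero => simp
  | add x x' h h' => simp only [map_add, LinearMap.add_apply, h, h']
  | single a c => simp [graftL, joinL, graft_ptT]

theorem graftL_join (x y z : TreeSp) :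
    graftL x (joinL y z) = joinL (graftL x y) z + joinL y (graftL x z) := by
  induction x using Finsupp.induction_linear with
  | zero => simp
  | add x x' h h' => simp only [map_add, LinearMap.add_apply, h, h']; abel
  | single a c =>
  induction y using Finsupp.induction_linear with
  | zero => simp
  | add x x' h h' => simp only [map_add, LinearMap.add_apply, h, h']; abel
  | single b c' =>
  induction z using Finsupp.induction_linear with
  | zero => simp
  | add x x' h h' => simp only [map_add, h, h']; abel
  | single r c'' =>
    have e : ∀ (t : RTree) (c : ℂ), single t c = c • single t (1 : ℂ) := by simp
    have g : ∀ t, graftL (single a 1) (single t 1) = graft a t := by simp [graftL]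
    rw [e a, e b, e r]
    simp only [map_smul, LinearMap.smul_apply, joinL_single, g, graft_joinT, smul_add]
    module

theorem sizeL_pt : sizeL (single ptT 1) = single ptT 1 := by
  simp [sizeL, size_ptT]

theorem sizeL_join (y z : TreeSp) :
    sizeL (joinL y z) = joinL (sizeL y) z + joinL y (sizeL z) := by
  induction y using Finsupp.induction_linear with
  | zero => simp
  | add x x' h h' => simp only [map_add, LinearMap.add_apply, h, h']; abel
  | single b c' =>
  induction z using Finsupp.induction_linear with
  | zero => simp
  | add x x' h h' => simp only [map_add, h, h']; abel
  | single r c'' =>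
    simp only [sizeL, joinL, linearCombination_single, map_smul, LinearMap.smul_apply, size_joinT,
      smul_smul, Nat.cast_add, ← add_smul]
    congr 1
    ring

theorem pruneL_pt (x : TreeSp) : pruneL x (single ptT 1) = 0 := by
  induction x using Finsupp.induction_linear with
  | zero => simp
  | add x x' h h' => simp only [map_add, LinearMap.add_apply, h, h', add_zero]
  | single a c => simp [pruneL, prune_ptT]

theorem pruneL_join (x y z : TreeSp) :
    pruneL x (joinL y z) = pair x y • z + (joinL (pruneL x y) z + joinL y (pruneL x z)) := by
  classical
  induction x using Finsupp.induction_linear with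
  | zero => simp
  | add x x' h h' => simp only [map_add, LinearMap.add_apply, h, h', add_smul]; abel
  | single a c =>
  induction y using Finsupp.induction_linear with
  | zero => simp
  | add x x' h h' => simp only [map_add, LinearMap.add_apply, h, h', add_smul]; abel
  | single b c' =>
  induction z using Finsupp.induction_linear with
  | zero => simp
  | add x x' h h' => simp only [map_add, h, h', smul_add]; abel
  | single r c'' =>
    have e : ∀ (t : RTree) (c : ℂ), single t c = c • single t (1 : ℂ) := by simp
    have g : ∀ t, pruneL (single a 1) (single t 1) = prune a t := by simp [pruneL]
    have p : (pair (single a 1) (single b 1) : ℂ) = if b = a then 1 else 0 := by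
      simp [pair, Finsupp.single_apply]
    rw [e a, e b, e r]
    simp only [map_smul, LinearMap.smul_apply, joinL_single, g, prune_joinT, smul_add, p]
    split_ifs <;> simp only [smul_eq_mul] <;> module

theorem TreeSp.hom_ext {f g : Module.End ℂ TreeSp} (h₀ : f (single ptT 1) = g (single ptT 1))
    (h : ∀ y z, f y = g y → f z = g z → f (joinL y z) = g (joinL y z)) : f = g := by
  refine Finsupp.lhom_ext' fun t => LinearMap.ext_ring ?_
  change f (single t 1) = g (single t 1)
  induction t using RTree.rec_joinT with
  | h₀ => exact h₀
  | h s t hs ht =>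
    rw [← joinL_single]
    exact h _ _ hs ht

theorem graftL_comm (x y : TreeSp) :
    ⁅graftL x, graftL y⁆ = graftL (graftL x y) - graftL (graftL y x) := by
  rw [Ring.lie_def]
  refine TreeSp.hom_ext ?_ fun a b ha hb => ?_
  · simp only [LinearMap.sub_apply, Module.End.mul_apply, graftL_pt, graftL_join]
    rw [joinL_swap x y]
    abel
  · simp only [LinearMap.sub_apply, Module.End.mul_apply, graftL_join, map_add] at ha hb ⊢
    have e₁ := congrArg (fun w => joinL w b) ha
    have e₂ := congrArg (fun w => joinL a w) hb
    simp only [map_sub, LinearMap.sub_apply] at e₁ e₂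
    linear_combination (norm := module) e₁ + e₂

theorem pair_apply (s : RTree) (y : TreeSp) : pair (single s 1) y = y s := by
  simp [pair]

theorem pair_symm (x y : TreeSp) : pair x y = pair y x := by
  induction x using Finsupp.induction_linear with
  | zero => simp
  | add x x' h h' => simp only [map_add, LinearMap.add_apply, h, h']
  | single a c =>
  induction y using Finsupp.induction_linear with
  | zero => simp
  | add x x' h h' => simp only [map_add, LinearMap.add_apply, h, h']
  | single b c' =>
    classical
    simp only [pair, linearCombination_single, LinearMap.smul_apply, Finsupp.lapply_apply,
      Finsupp.single_apply, smul_eq_mul, eq_comm (a := a) (b := b)]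
    split_ifs <;> ring

theorem pair_pruneDual (t s : RTree) (y : TreeSp) :
    pair (pruneDual t s) y = pair (single s 1) (pruneL (single t 1) y) := by
  induction y using Finsupp.induction_linear with
  | zero => simp
  | add x x' h h' => simp only [map_add, h, h']
  | single a c =>
    have e : single a c = c • single a (1 : ℂ) := by simp
    rw [e, map_smul, map_smul, map_smul, pair_symm, pair_apply, pair_apply, pruneDual_apply]
    simp [pruneL, prune_apply]

theorem pair_graftDual (s t : RTree) (y : TreeSp) :
    pair (graftDual s t) y = pair (single s 1) (graftL (single t 1) y) := by
  induction y using Finsupp.induction_linear with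
  | zero => simp
  | add x x' h h' => simp only [map_add, h, h']
  | single a c =>
    have e : single a c = c • single a (1 : ℂ) := by simp
    rw [e, map_smul, map_smul, map_smul, pair_symm, pair_apply, pair_apply, graftDual_apply]
    simp [graftL, graft_apply]

theorem pair_sizeL (t : RTree) (y : TreeSp) :
    pair (single t 1) (sizeL y) = (size t : ℂ) * pair (single t 1) y := by
  classical
  induction y using Finsupp.induction_linear with
  | zero => simp
  | add x x' h h' => simp only [map_add, h, h', mul_add]
  | single a c =>
    simp only [pair_apply, sizeL, linearCombination_single, Finsupp.smul_apply,
      Finsupp.single_apply, smul_eq_mul]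
    split_ifs with h
    · subst h; ring
    · ring

theorem sizeL_single (t : RTree) : sizeL (single t 1) = (size t : ℂ) • single t 1 := by
  simp only [sizeL, linearCombination_single, one_smul]

theorem pruneL_comm (s t : RTree) :
    ⁅pruneL (single s 1), pruneL (single t 1)⁆ = pruneL (pruneDual t s - pruneDual s t) := by
  rw [Ring.lie_def]
  refine TreeSp.hom_ext ?_ fun a b ha hb => ?_
  · simp only [LinearMap.sub_apply, Module.End.mul_apply, pruneL_pt, map_zero, sub_zero]
  · simp only [LinearMap.sub_apply, Module.End.mul_apply, pruneL_join, map_add, map_sub, map_smul,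
      pair_pruneDual] at ha hb ⊢
    have e₁ := congrArg (fun w => joinL w b) ha
    have e₂ := congrArg (fun w => joinL a w) hb
    simp only [map_sub, LinearMap.sub_apply] at e₁ e₂
    linear_combination (norm := module) e₁ + e₂

theorem pruneL_graftL_comm (s t : RTree) :
    ⁅pruneL (single s 1), graftL (single t 1)⁆ =
      pair (single s 1) (single t 1) • sizeL +
        (graftL (prune s t) + pruneL (graftDual s t)) := by
  have hp : prune s t = pruneL (single s 1) (single t 1) := by simp [pruneL]
  rw [Ring.lie_def, hp]
  refine TreeSp.hom_ext ?_ fun a b ha hb => ?_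
  · simp only [LinearMap.sub_apply, LinearMap.add_apply, LinearMap.smul_apply,
      Module.End.mul_apply, pruneL_pt, map_zero, graftL_pt, pruneL_join, sizeL_pt]
    module
  · simp only [LinearMap.sub_apply, LinearMap.add_apply, LinearMap.smul_apply, sizeL_join,
      Module.End.mul_apply, pruneL_join, graftL_join, map_add, map_smul,
      pair_graftDual] at ha hb ⊢
    have e₁ := congrArg (fun w => joinL w b) ha
    have e₂ := congrArg (fun w => joinL a w) hb
    simp only [map_sub, LinearMap.sub_apply, map_add, LinearMap.add_apply, map_smul,
      LinearMap.smul_apply] at e₁ e₂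
    linear_combination (norm := module) e₁ + e₂

theorem sizeL_graftL_comm (t : RTree) :
    ⁅sizeL, graftL (single t 1)⁆ = (size t : ℂ) • graftL (single t 1) := by
  rw [Ring.lie_def]
  refine TreeSp.hom_ext ?_ fun a b ha hb => ?_
  · simp only [LinearMap.sub_apply, LinearMap.smul_apply,
      Module.End.mul_apply, graftL_pt, sizeL_join, sizeL_single, map_smul]
    module
  · simp only [LinearMap.sub_apply, LinearMap.smul_apply, sizeL_join,
      Module.End.mul_apply, graftL_join, map_add] at ha hb ⊢
    have e₁ := congrArg (fun w => joinL w b) ha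
    have e₂ := congrArg (fun w => joinL a w) hb
    simp only [map_sub, LinearMap.sub_apply, map_smul, LinearMap.smul_apply] at e₁ e₂
    linear_combination (norm := module) e₁ + e₂

theorem sizeL_pruneL_comm (t : RTree) :
    ⁅sizeL, pruneL (single t 1)⁆ = -(size t : ℂ) • pruneL (single t 1) := by
  rw [Ring.lie_def]
  refine TreeSp.hom_ext ?_ fun a b ha hb => ?_
  · simp only [LinearMap.sub_apply, LinearMap.smul_apply,
      Module.End.mul_apply, pruneL_pt, sizeL_pt, map_zero, smul_zero, sub_zero]
  · simp only [LinearMap.sub_apply, LinearMap.smul_apply, sizeL_join,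
      Module.End.mul_apply, pruneL_join, map_add, map_smul, pair_sizeL] at ha hb ⊢
    have e₁ := congrArg (fun w => joinL w b) ha
    have e₂ := congrArg (fun w => joinL a w) hb
    simp only [map_sub, LinearMap.sub_apply, map_smul, LinearMap.smul_apply] at e₁ e₂
    linear_combination (norm := module) e₁ + e₂

/-- The operator by which a basis element acts on `TreeSp`. -/
def genAct : Gen → Module.End ℂ TreeSp
  | Gen.d => sizeL
  | Gen.plus t => graftL (single t 1)
  | Gen.minus t => pruneL (single t 1)

/-- The action of the insertion-elimination algebra on `TreeSp`. -/
def treeAct : InsElimAlg →ₗ[ℂ] Module.End ℂ TreeSp := genBasis.constr ℂ genAct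

theorem treeAct_d : treeAct dElt = sizeL := genBasis.constr_basis ℂ _ _

theorem treeAct_plus (t : RTree) : treeAct (Dplus t) = graftL (single t 1) :=
  genBasis.constr_basis ℂ _ _

theorem treeAct_minus (t : RTree) : treeAct (Dminus t) = pruneL (single t 1) :=
  genBasis.constr_basis ℂ _ _

theorem finsum_eq_linearCombination {M : Type*} [AddCommGroup M] [Module ℂ M] (x : TreeSp)
    (f : RTree → M) : ∑ᶠ r, x r • f r = linearCombination ℂ f x := by
  rw [linearCombination_apply, Finsupp.sum]
  refine finsum_eq_sum_of_support_subset _ fun r hr => ?_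
  simp only [Finset.mem_coe, Finsupp.mem_support_iff]
  intro h
  exact hr (by simp [h])

theorem treeAct_sum_plus (x : TreeSp) : treeAct (∑ᶠ r, x r • Dplus r) = graftL x := by
  rw [finsum_eq_linearCombination]
  induction x using Finsupp.induction_linear with
  | zero => simp
  | add x y hx hy => simp only [map_add, hx, hy]
  | single a c =>
    have e : single a c = c • single a (1 : ℂ) := by simp
    rw [linearCombination_single, map_smul, treeAct_plus, e, map_smul]

theorem treeAct_sum_minus (x : TreeSp) : treeAct (∑ᶠ r, x r • Dminus r) = pruneL x := by
  rw [finsum_eq_linearCombination]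
  induction x using Finsupp.induction_linear with
  | zero => simp
  | add x y hx hy => simp only [map_add, hx, hy]
  | single a c =>
    have e : single a c = c • single a (1 : ℂ) := by simp
    rw [linearCombination_single, map_smul, treeAct_minus, e, map_smul]

theorem treeAct_minusPlus (s t : RTree) :
    treeAct (minusPlus s t) = ⁅pruneL (single s 1), graftL (single t 1)⁆ := by
  classical
  have h₁ : (∑ᶠ r, (alpha s t r : ℂ) • Dplus r) = ∑ᶠ r, prune s t r • Dplus r := by
    simp only [prune_apply]
  have h₂ : (∑ᶠ r, (beta s t r : ℂ) • Dminus r) = ∑ᶠ r, graftDual s t r • Dminus r := rfl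
  rw [pruneL_graftL_comm, minusPlus, map_add, map_add, h₁, h₂, treeAct_sum_plus,
    treeAct_sum_minus, pair_apply, Finsupp.single_apply]
  congr 1
  by_cases h : s = t
  · simp [h, treeAct_d]
  · simp [h, Ne.symm h]

theorem ring_lie_skew {R : Type*} [Ring R] (a b : R) : ⁅a, b⁆ = -⁅b, a⁆ := by
  rw [Ring.lie_def, Ring.lie_def, neg_sub]

theorem ring_leibniz {R : Type*} [Ring R] (a b c : R) :
    ⁅a, ⁅b, c⁆⁆ = ⁅⁅a, b⁆, c⁆ + ⁅b, ⁅a, c⁆⁆ := by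
  simp only [Ring.lie_def]
  noncomm_ring

theorem treeAct_genBracket (x y : Gen) :
    treeAct (genBracket x y) = ⁅genAct x, genAct y⁆ := by
  cases x with
  | d =>
    cases y with
    | d => simp [genBracket, Ring.lie_def]
    | plus t => rw [genBracket, map_smul, treeAct_plus, genAct, genAct, sizeL_graftL_comm]
    | minus t => rw [genBracket, map_smul, treeAct_minus, genAct, genAct, sizeL_pruneL_comm]
  | plus s =>
    cases y with
    | d => 
      rw [genBracket, map_smul, treeAct_plus, genAct, genAct, ring_lie_skew, sizeL_graftL_comm]
      module
    | plus t =>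
      have h : genBracket (Gen.plus s) (Gen.plus t) =
          ∑ᶠ r, (graft s t - graft t s) r • Dplus r := by
        simp only [genBracket, Finsupp.sub_apply, graft_apply]
      have g : ∀ a b, graftL (single a 1) (single b 1) = graft a b := by simp [graftL]
      rw [h, treeAct_sum_plus, genAct, genAct, graftL_comm, g, g, map_sub]
    | minus t => 
      rw [genBracket, map_neg, treeAct_minusPlus, genAct, genAct]
      exact (ring_lie_skew _ _).symm
  | minus s =>
    cases y with
    | d => 
      rw [genBracket, map_smul, treeAct_minus, genAct, genAct, ring_lie_skew, sizeL_pruneL_comm]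
      module
    | plus t => rw [genBracket, treeAct_minusPlus, genAct, genAct]
    | minus t =>
      have h : genBracket (Gen.minus s) (Gen.minus t) =
          ∑ᶠ r, (pruneDual t s - pruneDual s t) r • Dminus r := rfl
      rw [h, treeAct_sum_minus, genAct, genAct, pruneL_comm]

theorem bracketMap_basis (x y : Gen) :
    bracketMap (genBasis x) (genBasis y) = genBracket x y := by
  rw [bracketMap, Module.Basis.constr_basis, Module.Basis.constr_basis]

theorem treeAct_bracket (x y : InsElimAlg) :
    treeAct (bracketMap x y) = ⁅treeAct x, treeAct y⁆ := by
  have h : bracketMap.compr₂ treeAct =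
      LinearMap.mk₂ ℂ (fun x y => ⁅treeAct x, treeAct y⁆)
        (fun a b c => by simp only [map_add, Ring.lie_def, add_mul, mul_add]; abel)
        (fun r a b => by
          simp only [map_smul, Ring.lie_def, smul_mul_assoc, mul_smul_comm, smul_sub])
        (fun a b c => by simp only [map_add, Ring.lie_def, add_mul, mul_add]; abel)
        (fun r a b => by
          simp only [map_smul, Ring.lie_def, smul_mul_assoc, mul_smul_comm, smul_sub]) := by
    refine genBasis.ext fun a => genBasis.ext fun b => ?_
    rw [LinearMap.compr₂_apply, LinearMap.mk₂_apply, bracketMap_basis, treeAct_genBracket]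
    unfold treeAct
    rw [Module.Basis.constr_basis, Module.Basis.constr_basis]
  exact LinearMap.congr_fun₂ h x y

theorem TreeSp.joinL_ptT (x : TreeSp) :
    joinL x (single ptT 1) = Finsupp.mapDomain (fun s => joinT s ptT) x := by
  induction x using Finsupp.induction_linear with
  | zero => simp
  | add x y hx hy => simp only [map_add, LinearMap.add_apply, hx, hy, Finsupp.mapDomain_add]
  | single a c => simp [joinL, Finsupp.mapDomain_single]

theorem TreeSp.joinL_apply_ptT (x y : TreeSp) : joinL x y ptT = 0 := by
  induction x using Finsupp.induction_linear with
  | zero => simp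
  | add x x' h h' => simp only [map_add, LinearMap.add_apply, Finsupp.add_apply, h, h', add_zero]
  | single a c =>
  induction y using Finsupp.induction_linear with
  | zero => simp
  | add x x' h h' => simp only [map_add, Finsupp.add_apply, h, h', add_zero]
  | single b c' => simp [joinL, joinT_ne_ptT]

theorem treeAct_injective : Function.Injective treeAct := by
  rw [injective_iff_map_eq_zero]
  intro x hx
  let cd : InsElimAlg →ₗ[ℂ] ℂ := genBasis.constr ℂ fun g => match g with
    | Gen.d => 1
    | Gen.plus _ => 0
    | Gen.minus _ => 0
  let cp : InsElimAlg →ₗ[ℂ] TreeSp := genBasis.constr ℂ fun g => match g with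
    | Gen.d => 0
    | Gen.plus t => single t 1
    | Gen.minus _ => 0
  let cm : InsElimAlg →ₗ[ℂ] TreeSp := genBasis.constr ℂ fun g => match g with
    | Gen.d => 0
    | Gen.plus _ => 0
    | Gen.minus t => single t 1
  have key₁ : cd.smulRight sizeL + (graftL.comp cp + pruneL.comp cm) = treeAct := by
    refine genBasis.ext fun g => ?_
    rw [LinearMap.add_apply, LinearMap.add_apply, LinearMap.smulRight_apply,
      LinearMap.comp_apply, LinearMap.comp_apply, Module.Basis.constr_basis,
      Module.Basis.constr_basis, Module.Basis.constr_basis]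
    unfold treeAct
    rw [Module.Basis.constr_basis]
    cases g <;> simp [genAct]
  have key₂ : cd.smulRight dElt + ((linearCombination ℂ Dplus).comp cp +
      (linearCombination ℂ Dminus).comp cm) = LinearMap.id := by
    refine genBasis.ext fun g => ?_
    rw [LinearMap.add_apply, LinearMap.add_apply, LinearMap.smulRight_apply,
      LinearMap.comp_apply, LinearMap.comp_apply, Module.Basis.constr_basis,
      Module.Basis.constr_basis, Module.Basis.constr_basis]
    cases g <;> simp [dElt, Dplus, Dminus]
  have hx' : cd x • sizeL + (graftL (cp x) + pruneL (cm x)) = 0 := by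
    rw [← hx]
    exact LinearMap.congr_fun key₁ x
  have h₀ := LinearMap.congr_fun hx' (single ptT 1)
  simp only [LinearMap.add_apply, LinearMap.smul_apply, sizeL_pt, graftL_pt, pruneL_pt, add_zero,
    LinearMap.zero_apply] at h₀
  have hd : cd x = 0 := by
    have := DFunLike.congr_fun h₀ ptT
    simpa [TreeSp.joinL_apply_ptT] using this
  have hp : cp x = 0 := by
    rw [hd, zero_smul, zero_add, TreeSp.joinL_ptT] at h₀
    refine Finsupp.mapDomain_injective (fun a b h => joinT_ptT_inj h) ?_
    rw [h₀, Finsupp.mapDomain_zero]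
  have hm : cm x = 0 := by
    ext s
    have h₁ := LinearMap.congr_fun hx' (joinL (single s 1) (single ptT 1))
    rw [hd, hp] at h₁
    simp only [zero_smul, map_zero, zero_add, pruneL_join, pruneL_pt, add_zero,
      LinearMap.zero_apply] at h₁
    have := DFunLike.congr_fun h₁ ptT
    simpa [TreeSp.joinL_apply_ptT, pair_symm (cm x), pair_apply] using this
  have := LinearMap.congr_fun key₂ x
  rw [LinearMap.add_apply, LinearMap.add_apply, LinearMap.smulRight_apply,
    LinearMap.comp_apply, LinearMap.comp_apply, hd, hp, hm] at this
  simpa using this.symm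

/-! ### The insertion-elimination Lie algebra -/

/-- The bracket of `InsElimAlg` makes it a Lie algebra. -/
instance : LieRing InsElimAlg where
  bracket x y := bracketMap x y
  add_lie x y z := by
    change bracketMap (x + y) z = bracketMap x z + bracketMap y z
    rw [map_add, LinearMap.add_apply]
  lie_add x y z := map_add (bracketMap x) y z
  lie_self x := treeAct_injective <| by
    change treeAct (bracketMap x x) = treeAct 0
    rw [treeAct_bracket, Ring.lie_def, sub_self, map_zero]
  leibniz_lie x y z := treeAct_injective <| by
    change treeAct (bracketMap x (bracketMap y z)) =
      treeAct (bracketMap (bracketMap x y) z + bracketMap y (bracketMap x z))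
    simp only [map_add, treeAct_bracket]
    exact ring_leibniz _ _ _

instance : LieAlgebra ℂ InsElimAlg where
  lie_smul c x y := map_smul (bracketMap x) c y

theorem lie_basis (x y : Gen) : ⁅genBasis x, genBasis y⁆ = genBracket x y := bracketMap_basis x y

theorem lie_plus_plus (s t : RTree) : ⁅Dplus s, Dplus t⁆ =
    ∑ᶠ r, ((beta r s t : ℂ) - (beta r t s : ℂ)) • Dplus r := lie_basis _ _

/-- The subalgebra `𝔫⁺`, the span of the elements `D_t^+`. -/
def nPlus : LieSubalgebra ℂ InsElimAlg where
  __ := Submodule.span ℂ (Set.range Dplus)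
  lie_mem' {x y} hx hy := by
    change ⁅x, y⁆ ∈ Submodule.span ℂ (Set.range Dplus)
    replace hx : x ∈ Submodule.span ℂ (Set.range Dplus) := hx
    replace hy : y ∈ Submodule.span ℂ (Set.range Dplus) := hy
    induction hx, hy using Submodule.span_induction₂ with
    | mem_mem x y hx hy =>
      obtain ⟨s, rfl⟩ := hx
      obtain ⟨t, rfl⟩ := hy
      rw [lie_plus_plus]
      exact finsum_induction (· ∈ Submodule.span ℂ (Set.range Dplus)) (zero_mem _)
        (fun _ _ => add_mem)
        fun r => Submodule.smul_mem _ _ (Submodule.subset_span (Set.mem_range_self r))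
    | zero_left y hy => rw [zero_lie]; exact zero_mem _
    | zero_right x hx => rw [lie_zero]; exact zero_mem _
    | add_left x y z _ _ _ h₁ h₂ => rw [add_lie]; exact add_mem h₁ h₂
    | add_right x y z _ _ _ h₁ h₂ => rw [lie_add]; exact add_mem h₁ h₂
    | smul_left c x y _ _ h => rw [smul_lie]; exact Submodule.smul_mem _ _ h
    | smul_right c x y _ _ h => rw [lie_smul]; exact Submodule.smul_mem _ _ h

/-- The element `D_t^+` of `𝔫⁺`. -/
def nPlusD (t : RTree) : nPlus :=
  ⟨Dplus t, Submodule.subset_span (Set.mem_range_self t)⟩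

/-- The homomorphism `η : 𝔫⁺ → ℂ` has finite support: for some positive integer `M`,
`η(D_t^+) = 0` whenever `|t| ≥ M`. -/
def FiniteSupport (η : LieAlgebra.LieCharacter ℂ nPlus) : Prop :=
  ∃ M : ℕ, 0 < M ∧ ∀ t : RTree, M ≤ size t → η (nPlusD t) = 0

/-! ### Induced modules and standard Whittaker modules -/

section Induced

open scoped TensorProduct

variable {k A B W : Type*} [CommRing k] [Ring A] [Algebra k A] [Ring B] [Algebra k B]
  [AddCommGroup W] [Module k W]

/-- The `B`-submodule of `B ⊗[k] W` spanned by the elements `bφ(a) ⊗ w - b ⊗ aw`, where `a ∈ A`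
acts on `W` through `ρ`. -/
def balancing (φ : A →ₐ[k] B) (ρ : A →ₐ[k] Module.End k W) : Submodule B (B ⊗[k] W) :=
  Submodule.span B {x | ∃ (b : B) (a : A) (w : W), x = (b * φ a) ⊗ₜ[k] w - b ⊗ₜ[k] (ρ a w)}

/-- The tensor product `B ⊗_A W` of `B`, a right `A`-module through `φ`, and the left `A`-module
`W` given by `ρ`; it is a left `B`-module. -/
abbrev InducedModule (φ : A →ₐ[k] B) (ρ : A →ₐ[k] Module.End k W) : Type _ :=
  (B ⊗[k] W) ⧸ balancing φ ρ

end Induced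

attribute [local instance] LieRing.ofAssociativeRing in
/-- The algebra homomorphism `U(𝔫⁺) → U(𝔤)` given by the inclusion of `𝔫⁺` in `𝔤`. -/
def envInclusion :
    UniversalEnvelopingAlgebra ℂ nPlus →ₐ[ℂ] UniversalEnvelopingAlgebra ℂ InsElimAlg :=
  UniversalEnvelopingAlgebra.lift ℂ ((UniversalEnvelopingAlgebra.ι ℂ).comp nPlus.incl)

/-- The one-dimensional `U(𝔫⁺)`-module `ℂ_η`: the element `x` of `𝔫⁺` acts on `ℂ` as
multiplication by `η(x)`. -/
def oneDimAct (η : LieAlgebra.LieCharacter ℂ nPlus) :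
    UniversalEnvelopingAlgebra ℂ nPlus →ₐ[ℂ] Module.End ℂ ℂ :=
  (Algebra.lmul ℂ ℂ).comp (UniversalEnvelopingAlgebra.lift ℂ η)

/-- The standard Whittaker module `M_η = U(𝔤) ⊗_{U(𝔫⁺)} ℂ_η`. -/
abbrev StdWhittaker (η : LieAlgebra.LieCharacter ℂ nPlus) : Type :=
  InducedModule envInclusion (oneDimAct η)

/-- The space of Whittaker vectors of type `η` in a `U(𝔤)`-module `V`: the vectors `v` with
`x v = η(x) v` for all `x ∈ 𝔫⁺`. -/
def whittakerVectors (η : LieAlgebra.LieCharacter ℂ nPlus) (V : Type*) [AddCommGroup V]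
    [Module ℂ V] [Module (UniversalEnvelopingAlgebra ℂ InsElimAlg) V]
    [IsScalarTower ℂ (UniversalEnvelopingAlgebra ℂ InsElimAlg) V] : Submodule ℂ V where
  carrier := {v | ∀ x : nPlus,
    UniversalEnvelopingAlgebra.ι ℂ (x : InsElimAlg) • v = η x • v}
  zero_mem' x := by rw [smul_zero, smul_zero]
  add_mem' {v w} hv hw x := by rw [smul_add, smul_add, hv x, hw x]
  smul_mem' c v hv x := by
    rw [← algebraMap_smul (UniversalEnvelopingAlgebra ℂ InsElimAlg) c v, ← mul_smul,
      ← Algebra.commutes, mul_smul, hv x, algebraMap_smul, algebraMap_smul, smul_comm]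

end InsElim

end

noncomputable section

namespace InsElim

open OTree RTree Finsupp

/-! ### Sizes and components of rooted trees -/

/-! Let w be the class of 1 ⊗ 1, which generates M_η. Three facts suffice: w ≠ 0; every nonzero
submodule contains a nonzero Whittaker vector; every Whittaker vector is a multiple of w. A nonzero
submodule then contains w, hence is everything. The PBW theorem is not used: ordered monomials need
only span, and w ≠ 0 is seen in an explicit module.

Nonvanishing (`whittakerGenerator_ne_zero`). The algebra acts on trees by grafting and pruning,
hence on the dual of `TreeSp`. A nonzero functional on which 𝔫⁺ acts through η is built by recursion
on the number of branches at the root (`exists_eigenfunctional`). The value must not depend on which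
branch is removed; this follows from the commutator relation of grafting and the vanishing of η on
brackets. Sending w to this functional gives a map out of M_η.

Existence (`exists_whittaker_mem`). The vectors D⁻⋯D⁻ d^j w filter M_η by twice the total size of
the trees plus j, and D_t⁺ − η(D_t⁺) strictly lowers this filtration. A nonzero vector of lowest
level in a submodule is therefore a Whittaker vector.

Uniqueness (`eq_smul_of_whittaker`). Let N be the largest size of a tree on which η is nonzero.
Write a Whittaker vector v as a sum of ordered words D_m⁻ p_m(d) w, and let W be the largest weight
that occurs. For |t| = N + W the operator D_t⁺ turns each word into a scalar times p_m(d − N) w, the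
scalar being, up to sign, η evaluated on t pruned along m. If W > 0, then D_t⁺ v = 0, and
independence of the d^j w gives linear relations between pruned functionals. These are independent
(`exists_sum_prunedFunctional_ne_zero`): to leading order in the root degree, pruning a branch s is
∂/∂X_s on polynomials in the trees, its dual is multiplication by X_s, and a polynomial ring over ℂ
is a domain. Hence W = 0 and v = p(d) w; then p(X − N) = p, so p is constant. -/

theorem OTree.card_vert_attach (t : OTree) (v : Vert t) (u : OTree) :
    Nat.card (Vert (attach t v u)) = Nat.card (Vert t) + Nat.card (Vert u) := by
  induction t with
  | pt =>
    change Nat.card (Vert u ⊕ Unit) = Nat.card Unit + _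
    rw [Nat.card_sum, add_comm]
  | join s t hs ht =>
    rcases v with v | v
    · change Nat.card (Vert (attach s v u) ⊕ Vert t) = Nat.card (Vert s ⊕ Vert t) + _
      rw [Nat.card_sum, Nat.card_sum, hs]
      ring
    · change Nat.card (Vert s ⊕ Vert (attach t v u)) = Nat.card (Vert s ⊕ Vert t) + _
      rw [Nat.card_sum, Nat.card_sum, ht]
      ring

namespace RTree

theorem size_pos (t : RTree) : 0 < size t := by
  induction t using rec_joinT with
  | h₀ => simp [size_ptT]
  | h s t hs ht => rw [size_joinT]; omega

theorem size_eq_of_beta_ne_zero {r u t : RTree} (h : beta r u t ≠ 0) :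
    size r = size t + size u := by
  induction u using RTree.ind with | h u =>
  induction t using RTree.ind with | h t =>
  have h' : Nat.card {v : Vert t // r = mk (attach t v u)} ≠ 0 := h
  obtain ⟨⟨v, rfl⟩⟩ := (Nat.card_ne_zero.1 h').1
  exact OTree.card_vert_attach t v u

theorem size_eq_of_alpha_ne_zero {s t r : RTree} (h : alpha s t r ≠ 0) :
    size t = size r + size s := by
  induction t using RTree.ind with | h t =>
  have h' : Nat.card {e : Edge t // mk (rootPart t e) = r ∧ mk (branchPart t e) = s} ≠ 0 := h
  obtain ⟨⟨e, rfl, rfl⟩⟩ := (Nat.card_ne_zero.1 h').1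
  obtain ⟨v, hv⟩ := t.exists_vert_edge e
  rw [← mk_eq.2 hv]
  exact OTree.card_vert_attach _ v _

/-- Every tree is the one-vertex tree or `joinT` of two strictly smaller trees, so each step adds
only finitely many. -/
theorem finite_size_le (n : ℕ) : {t : RTree | size t ≤ n}.Finite := by
  induction n with
  | zero =>
    refine Set.finite_empty.subset fun t (ht : size t ≤ 0) => ?_
    have := size_pos t
    omega
  | succ n ih =>
    refine ((Set.finite_singleton ptT).union (ih.image2 joinT ih)).subset ?_
    intro t (ht : size t ≤ n + 1)
    induction t using rec_joinT with
    | h₀ => exact Or.inl rfl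
    | h s t =>
      rw [size_joinT] at ht
      have := size_pos s
      have := size_pos t
      refine Or.inr ⟨s, ?_, t, ?_, rfl⟩ <;> simp only [Set.mem_ofPred_eq] <;> omega

theorem exists_joinT_of_mem_components {s t : RTree} (h : s ∈ components t) :
    ∃ t', t = joinT s t' := by
  induction t using rec_joinT with
  | h₀ => simp [components_ptT] at h
  | h a b _ hb =>
    rw [components_joinT, Multiset.mem_cons] at h
    rcases h with rfl | h
    · exact ⟨b, rfl⟩
    · obtain ⟨b', rfl⟩ := hb h
      exact ⟨joinT a b', joinT_swap _ _ _⟩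

theorem eq_ptT_of_components_eq_zero {t : RTree} (h : components t = 0) : t = ptT := by
  induction t using rec_joinT with
  | h₀ => rfl
  | h a b => simp [components_joinT] at h

theorem components_injective : Function.Injective components := by
  intro t
  induction t using rec_joinT with
  | h₀ => exact fun t' h => (eq_ptT_of_components_eq_zero (h.symm.trans components_ptT)).symm
  | h a b _ hb =>
    intro t' h
    have ha : a ∈ components t' := h ▸ by simp [components_joinT]
    obtain ⟨b', rfl⟩ := exists_joinT_of_mem_components ha
    rw [components_joinT, components_joinT, Multiset.cons_inj_right] at h
    rw [hb h]

theorem components_surjective : Function.Surjective components := by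
  intro m
  induction m using Multiset.induction with
  | empty => exact ⟨ptT, components_ptT⟩
  | cons a m ih =>
    obtain ⟨t, rfl⟩ := ih
    exact ⟨joinT a t, components_joinT a t⟩

theorem joinT_right_injective (s : RTree) : Function.Injective (joinT s) := by
  intro t t' h
  have := congrArg components h
  rw [components_joinT, components_joinT, Multiset.cons_inj_right] at this
  exact components_injective this

/-- The components form a multiset, so two ways of splitting off a branch either agree or remove two
of the branches of a common tree in opposite orders. This is the ambiguity to be resolved in the
recursion of `removeBranches`. -/
theorem joinT_eq_joinT {s t s' t' : RTree} (h : joinT s t = joinT s' t') :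
    (s = s' ∧ t = t') ∨ ∃ r, t = joinT s' r ∧ t' = joinT s r := by
  have h' : s' ∈ components (joinT s t) := by rw [h, components_joinT]; simp
  rw [components_joinT, Multiset.mem_cons] at h'
  rcases h' with rfl | h'
  · exact Or.inl ⟨rfl, joinT_right_injective _ h⟩
  · obtain ⟨r, rfl⟩ := exists_joinT_of_mem_components h'
    rw [joinT_swap] at h
    exact Or.inr ⟨r, rfl, (joinT_right_injective _ h).symm⟩

/-- The number of branches at the root. -/
def rootDegree (t : RTree) : ℕ := Multiset.card (components t)

theorem rootDegree_ptT : rootDegree ptT = 0 := rfl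

theorem rootDegree_joinT (s t : RTree) : rootDegree (joinT s t) = rootDegree t + 1 := by
  rw [rootDegree, components_joinT, Multiset.card_cons, rootDegree]

theorem eq_ptT_of_rootDegree_eq_zero {t : RTree} (h : rootDegree t = 0) : t = ptT :=
  eq_ptT_of_components_eq_zero (Multiset.card_eq_zero.1 h)

end RTree

/-- The span of the trees with `k` branches at the root. -/
def degreeSp (k : ℕ) : Submodule ℂ TreeSp := Finsupp.supported ℂ ℂ {t | rootDegree t = k}

theorem single_mem_degreeSp (t : RTree) (c : ℂ) : single t c ∈ degreeSp (rootDegree t) :=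
  Finsupp.single_mem_supported ℂ c rfl

theorem eqOn_degreeSp {M : Type*} [AddCommGroup M] [Module ℂ M] {k : ℕ} {f g : TreeSp →ₗ[ℂ] M}
    (h : ∀ t, rootDegree t = k → f (single t 1) = g (single t 1)) {x : TreeSp}
    (hx : x ∈ degreeSp k) : f x = g x := by
  rw [← Finsupp.sum_single x, Finsupp.sum, map_sum, map_sum]
  refine Finset.sum_congr rfl fun t ht => ?_
  have e : single t (x t) = x t • single t (1 : ℂ) := by simp
  rw [e, map_smul, map_smul, h t (hx ht)]

theorem joinL_mem_degreeSp (x : TreeSp) {y : TreeSp} {k : ℕ} (hy : y ∈ degreeSp k) :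
    joinL x y ∈ degreeSp (k + 1) := by
  induction x using Finsupp.induction_linear with
  | zero => simp
  | add x x' h h' => rw [map_add, LinearMap.add_apply]; exact add_mem h h'
  | single a c =>
    rw [← Finsupp.sum_single y, Finsupp.sum, map_sum]
    refine sum_mem fun t ht => ?_
    rw [joinL, linearCombination_single, LinearMap.smul_apply, linearCombination_single]
    refine Submodule.smul_mem _ _ (Submodule.smul_mem _ _ ?_)
    have ht' : rootDegree t = k := hy ht
    rw [← ht', ← rootDegree_joinT a t]
    exact single_mem_degreeSp _ _

/-- The part of the grafting of `x` that leaves the root untouched. -/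
def deepGraftL (x : TreeSp) : Module.End ℂ TreeSp := graftL x - joinL x

theorem deepGraftL_pt (x : TreeSp) : deepGraftL x (single ptT 1) = 0 := by
  rw [deepGraftL, LinearMap.sub_apply, graftL_pt, sub_self]

theorem deepGraftL_join (x y z : TreeSp) :
    deepGraftL x (joinL y z) = joinL (graftL x y) z + joinL y (deepGraftL x z) := by
  simp only [deepGraftL, LinearMap.sub_apply, graftL_join, map_sub, joinL_swap x y z]
  abel

/-- `deepGraftL` satisfies the same commutator relation as `graftL`: the terms with a graft at the
root cancel, by the derivation rule and the symmetry of joining two branches. -/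
theorem deepGraftL_comm (x y z : TreeSp) :
    deepGraftL x (deepGraftL y z) + deepGraftL (graftL y x) z =
      deepGraftL y (deepGraftL x z) + deepGraftL (graftL x y) z := by
  have h := LinearMap.congr_fun (graftL_comm x y) z
  rw [Ring.lie_def] at h
  simp only [LinearMap.sub_apply, Module.End.mul_apply, deepGraftL, map_sub, graftL_join] at h ⊢
  rw [joinL_swap x y z]
  linear_combination (norm := module) h

theorem deepGraftL_mem_degreeSp (x : TreeSp) {y : TreeSp} {k : ℕ} (hy : y ∈ degreeSp k) :
    deepGraftL x y ∈ degreeSp k := by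
  rw [← Finsupp.sum_single y, Finsupp.sum, map_sum]
  refine sum_mem fun t ht => ?_
  have e : single t (y t) = y t • single t (1 : ℂ) := by simp
  rw [e, map_smul]
  refine Submodule.smul_mem _ _ ?_
  have ht' : rootDegree t = k := hy ht
  subst ht'
  clear hy e ht
  induction t using rec_joinT with
  | h₀ => rw [deepGraftL_pt]; exact zero_mem _
  | h s t _ ih =>
    rw [← joinL_single, deepGraftL_join, rootDegree_joinT]
    exact add_mem (joinL_mem_degreeSp _ (single_mem_degreeSp _ _)) (joinL_mem_degreeSp _ ih)

/-! ### Eigenvectors in the dual of `TreeSp` -/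

section Eigenfunctional

variable (h : TreeSp →ₗ[ℂ] ℂ)

open Classical in
/-- The functionals on `TreeSp` obtained by removing branches at the root one by one: the `k`-th
is meant for trees with `k` branches at the root. -/
def removeBranches : ℕ → TreeSp →ₗ[ℂ] ℂ
  -- Only the one-vertex tree has no branch at the root, so this fixes one normalisation, which
  -- later shows that the eigenfunctional is nonzero.
  | 0 => linearCombination ℂ fun _ => 1
  | k + 1 => linearCombination ℂ fun t =>
      if ht : ∃ p : RTree × RTree, t = joinT p.1 p.2 then
        h (single ht.choose.1 1) * removeBranches k (single ht.choose.2 1) -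
          removeBranches k (deepGraftL (single ht.choose.1 1) (single ht.choose.2 1))
      else 0

open Classical in
theorem removeBranches_succ_single (k : ℕ) (t : RTree) :
    removeBranches h (k + 1) (single t 1) =
      if ht : ∃ p : RTree × RTree, t = joinT p.1 p.2 then
        h (single ht.choose.1 1) * removeBranches h k (single ht.choose.2 1) -
          removeBranches h k (deepGraftL (single ht.choose.1 1) (single ht.choose.2 1))
      else 0 := by
  rw [removeBranches, linearCombination_single, one_smul]

/-- Since `graftL x = joinL x + deepGraftL x`, where the first term raises the root degree by one
and the second preserves it, this recursion is the eigenvector equation. The definition imposes it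
only for one chosen branch; the point is that it then holds for every branch. -/
theorem removeBranches_joinL (hh : ∀ x y, h (graftL x y) = h (graftL y x)) (k : ℕ) (x : TreeSp)
    {y : TreeSp} (hy : y ∈ degreeSp k) :
    removeBranches h (k + 1) (joinL x y) =
      h x * removeBranches h k y - removeBranches h k (deepGraftL x y) := by
  -- Both sides are bilinear, so trees suffice. The linear form is also needed inside the induction,
  -- where it is applied to `graftL` and `deepGraftL` of trees.
  have reduce : ∀ k, (∀ s t, rootDegree t = k →
      removeBranches h (k + 1) (single (joinT s t) 1) =
        h (single s 1) * removeBranches h k (single t 1) -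
          removeBranches h k (deepGraftL (single s 1) (single t 1))) →
      ∀ x, ∀ y ∈ degreeSp k, removeBranches h (k + 1) (joinL x y) =
        h x * removeBranches h k y - removeBranches h k (deepGraftL x y) := by
    intro k H x y hy
    refine eqOn_degreeSp (f := (removeBranches h (k + 1)).comp (joinL x))
      (g := h x • removeBranches h k - (removeBranches h k).comp (deepGraftL x)) ?_ hy
    intro t ht
    simp only [LinearMap.comp_apply, LinearMap.sub_apply, LinearMap.smul_apply, smul_eq_mul]
    induction x using Finsupp.induction_linear with
    | zero => simp [deepGraftL]
    | add x x' h₁ h₂ =>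
      simp only [deepGraftL, map_add, LinearMap.add_apply, LinearMap.sub_apply, map_sub]
        at h₁ h₂ ⊢
      rw [h₁, h₂]
      ring
    | single a c =>
      have e : single a c = c • single a (1 : ℂ) := by simp
      have := H a t ht
      rw [e]
      simp only [deepGraftL, LinearMap.sub_apply, map_sub, map_smul, LinearMap.smul_apply,
        joinL_single, smul_eq_mul] at this ⊢
      rw [this]
      ring
  suffices ∀ k s t, rootDegree t = k →
      removeBranches h (k + 1) (single (joinT s t) 1) =
        h (single s 1) * removeBranches h k (single t 1) -
          removeBranches h k (deepGraftL (single s 1) (single t 1)) from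
    reduce k (this k) x y hy
  clear hy x y k
  intro k
  induction k with
  | zero =>
    intro s t ht
    obtain rfl := eq_ptT_of_rootDegree_eq_zero ht
    have hex : ∃ p : RTree × RTree, joinT s ptT = joinT p.1 p.2 := ⟨(s, ptT), rfl⟩
    rw [removeBranches_succ_single, dif_pos hex]
    have hc := hex.choose_spec
    have h₁ : hex.choose.2 = ptT := by
      have := congrArg rootDegree hc
      rw [rootDegree_joinT, rootDegree_joinT, rootDegree_ptT] at this
      exact eq_ptT_of_rootDegree_eq_zero (by omega)
    rw [h₁] at hc
    rw [h₁, ← joinT_ptT_inj hc]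
  | succ k ih =>
    intro s t ht
    have hex : ∃ p : RTree × RTree, joinT s t = joinT p.1 p.2 := ⟨(s, t), rfl⟩
    rw [removeBranches_succ_single, dif_pos hex]
    have hc := hex.choose_spec
    generalize hex.choose.1 = s' at hc ⊢
    generalize hex.choose.2 = t' at hc ⊢
    rcases joinT_eq_joinT hc with ⟨rfl, rfl⟩ | ⟨r, rfl, rfl⟩
    · rfl
    · have hr : rootDegree r = k := by
        rw [rootDegree_joinT] at ht
        omega
      have hr' : single r (1 : ℂ) ∈ degreeSp k := hr ▸ single_mem_degreeSp r 1
      have H := reduce k ih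
      have h₁ := H (single s 1) _ hr'
      have h₂ := H (single s' 1) _ hr'
      have h₃ := H (graftL (single s 1) (single s' 1)) _ hr'
      have h₄ := H (graftL (single s' 1) (single s 1)) _ hr'
      have h₅ := H (single s 1) _ (deepGraftL_mem_degreeSp (single s' 1) hr')
      have h₆ := H (single s' 1) _ (deepGraftL_mem_degreeSp (single s 1) hr')
      -- After both branches are removed, in either order, the two expansions differ by `h` of a
      -- commutator of graftings, which vanishes, and by the commutator of two deep graftings, which
      -- is this identity.
      have h₇ := congrArg (removeBranches h k)
        (deepGraftL_comm (single s 1) (single s' 1) (single r 1))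
      rw [← joinL_single, ← joinL_single, deepGraftL_join, deepGraftL_join, map_add, map_add,
        h₁, h₂, h₃, h₄, h₅, h₆]
      rw [map_add, map_add] at h₇
      rw [hh (single s' 1)]
      linear_combination h₇

/-- A functional that is a character of the Lie algebra of graftings is the eigenvalue of an
eigenvector in the dual of `TreeSp`. -/
theorem exists_eigenfunctional (hh : ∀ x y, h (graftL x y) = h (graftL y x)) :
    ∃ l : TreeSp →ₗ[ℂ] ℂ, l ≠ 0 ∧ ∀ x y, l (graftL x y) = h x * l y := by
  let l : TreeSp →ₗ[ℂ] ℂ := linearCombination ℂ fun t =>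
    removeBranches h (rootDegree t) (single t 1)
  have hl : ∀ k, ∀ y ∈ degreeSp k, l y = removeBranches h k y := fun k y hy =>
    eqOn_degreeSp (fun t ht => by simp [l, ht]) hy
  refine ⟨l, fun h0 => ?_, fun x y => ?_⟩
  · have := LinearMap.congr_fun h0 (single ptT 1)
    simp [l, rootDegree_ptT, removeBranches] at this
  · induction y using Finsupp.induction_linear with
    | zero => simp
    | add y y' h₁ h₂ => rw [map_add, map_add, map_add, h₁, h₂, mul_add]
    | single t c =>
      have ht := single_mem_degreeSp t c
      have h₁ : graftL x (single t c) = joinL x (single t c) + deepGraftL x (single t c) := by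
        simp [deepGraftL]
      rw [h₁, map_add, hl _ _ (joinL_mem_degreeSp x ht), hl _ _ (deepGraftL_mem_degreeSp x ht),
        removeBranches_joinL h hh _ x ht, hl _ _ ht]
      ring

end Eigenfunctional

/-! ### Leading terms of iterated pruning -/

/-- Only cutting an edge at the root lowers the root degree, and such a cut removes a component. -/
theorem prune_mem_degreeSp {s t : RTree} (h : s ∉ components t) :
    prune s t ∈ degreeSp (rootDegree t) := by
  induction t using rec_joinT with
  | h₀ => rw [prune_ptT]; exact zero_mem _
  | h a b _ ih =>
    rw [components_joinT, Multiset.mem_cons, not_or] at h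
    rw [prune_joinT, if_neg (Ne.symm h.1), zero_add, rootDegree_joinT]
    exact add_mem (joinL_mem_degreeSp _ (single_mem_degreeSp _ _))
      (joinL_mem_degreeSp _ (ih h.2))

-- Each root edge carrying a copy of `s` contributes one `t`; `joinT s t` has one copy more than
-- `t`. All other cuts keep the root degree. Thus, up to terms of higher root degree, pruning `s` is
-- the derivative ∂/∂X_s of the monomial of the components.
open Classical in
theorem prune_joinT_sub_mem_degreeSp (s t : RTree) :
    prune s (joinT s t) - (((components t).count s + 1 : ℕ) : ℂ) • single t 1 ∈
      degreeSp (rootDegree t + 1) := by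
  induction hn : rootDegree t generalizing t with
  | zero =>
    obtain rfl := eq_ptT_of_rootDegree_eq_zero hn
    rw [prune_joinT, if_pos rfl, prune_ptT, components_ptT]
    simp only [Multiset.count_zero, map_zero, add_zero, zero_add, Nat.cast_one, one_smul,
      add_sub_cancel_left]
    exact joinL_mem_degreeSp _ (single_mem_degreeSp _ _)
  | succ n ih =>
    have h₁ : joinL (prune s s) (single t 1) ∈ degreeSp (n + 1 + 1) :=
      joinL_mem_degreeSp _ (hn ▸ single_mem_degreeSp _ _)
    rw [prune_joinT, if_pos rfl]
    by_cases hs : s ∈ components t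
    · obtain ⟨r, rfl⟩ := exists_joinT_of_mem_components hs
      rw [rootDegree_joinT] at hn
      have h₂ := joinL_mem_degreeSp (single s 1) (ih r (by omega))
      rw [map_sub, map_smul, joinL_single] at h₂
      rw [components_joinT, Multiset.count_cons_self]
      convert add_mem h₁ h₂ using 1
      push_cast
      module
    · have h₂ := joinL_mem_degreeSp (single s 1) (prune_mem_degreeSp hs)
      rw [hn] at h₂
      rw [Multiset.count_eq_zero_of_notMem hs]
      convert add_mem h₁ h₂ using 1
      push_cast
      module

/-- The functional `x ↦ z (prune sₙ (⋯ (prune s₁ x)))` for `l = [s₁, …, sₙ]`. -/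
def prunedFunctional (z : TreeSp →ₗ[ℂ] ℂ) : List RTree → TreeSp →ₗ[ℂ] ℂ
  | [] => z
  | s :: l => (prunedFunctional z l).comp (pruneL (single s 1))

theorem prunedFunctional_cons (z : TreeSp →ₗ[ℂ] ℂ) (s : RTree) (l : List RTree) (t : RTree) :
    prunedFunctional z (s :: l) (single t 1) = prunedFunctional z l (prune s t) := by
  simp [prunedFunctional, pruneL]

theorem map_eq_zero_of_mem_degreeSp {f : TreeSp →ₗ[ℂ] ℂ} {k : ℕ}
    (hf : ∀ t, rootDegree t = k → f (single t 1) = 0) {x : TreeSp} (hx : x ∈ degreeSp k) :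
    f x = 0 :=
  eqOn_degreeSp (g := 0) hf hx

/-! ### Pruning as differentiation, and its dual as multiplication of polynomials -/

section LeadingTerm

variable {z : TreeSp →ₗ[ℂ] ℂ} {K : ℕ}

/-- Each pruning lowers the root degree by at most one. -/
theorem prunedFunctional_eq_zero (hz : ∀ t, K < rootDegree t → z (single t 1) = 0)
    (l : List RTree) {t : RTree} (ht : K + l.length < rootDegree t) :
    prunedFunctional z l (single t 1) = 0 := by
  classical
  induction l generalizing t with
  | nil => exact hz t ht
  | cons s l ih =>
    rw [List.length_cons] at ht
    rw [prunedFunctional_cons]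
    by_cases hs : s ∈ components t
    · obtain ⟨r, rfl⟩ := exists_joinT_of_mem_components hs
      rw [rootDegree_joinT] at ht
      have h := map_eq_zero_of_mem_degreeSp (f := prunedFunctional z l)
        (fun t' ht' => ih (by omega)) (prune_joinT_sub_mem_degreeSp s r)
      rw [map_sub, map_smul, ih (by omega), smul_zero, sub_zero] at h
      exact h
    · exact map_eq_zero_of_mem_degreeSp (fun t' ht' => ih (by omega)) (prune_mem_degreeSp hs)

open Classical in
/-- The multiplicities of the branches at the root. -/
def exponent (t : RTree) : RTree →₀ ℕ := Multiset.toFinsupp (components t)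

theorem exponent_joinT (s t : RTree) : exponent (joinT s t) = single s 1 + exponent t := by
  classical
  rw [exponent, components_joinT, ← Multiset.singleton_add, map_add, Multiset.toFinsupp_singleton]
  rfl

theorem exponent_injective : Function.Injective exponent := by
  classical exact fun _ _ h => components_injective (Multiset.toFinsupp.injective h)

theorem exponent_surjective : Function.Surjective exponent := by
  classical exact Multiset.toFinsupp.surjective.comp components_surjective

theorem mem_components_of_exponent_ne_zero {s t : RTree} (h : exponent t s ≠ 0) :
    s ∈ components t := by
  classical
  rw [exponent, Multiset.toFinsupp_apply] at h
  exact Multiset.count_ne_zero.1 h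

theorem degree_exponent (t : RTree) : (exponent t).degree = rootDegree t := by
  induction t using rec_joinT with
  | h₀ => simp [exponent, components_ptT, rootDegree_ptT]
  | h s t _ ih => rw [exponent_joinT, map_add, ih, rootDegree_joinT, Finsupp.degree_single, add_comm]

/-- The product of the factorials of the multiplicities of the branches at the root. -/
def branchFactorial (t : RTree) : ℂ := (exponent t).prod fun _ n => (n.factorial : ℂ)

theorem branchFactorial_ne_zero (t : RTree) : branchFactorial t ≠ 0 :=
  Finset.prod_ne_zero_iff.2 fun _ _ => Nat.cast_ne_zero.2 (Nat.factorial_ne_zero _)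

theorem branchFactorial_joinT (s t : RTree) :
    branchFactorial (joinT s t) = (exponent t s + 1 : ℕ) * branchFactorial t := by
  classical
  have h : ∀ f : RTree →₀ ℕ, (f.prod fun _ n => (n.factorial : ℂ)) =
      ((f s).factorial : ℂ) * (f.erase s).prod fun _ n => (n.factorial : ℂ) := fun f =>
    (Finsupp.mul_prod_erase' f s _ (by simp)).symm
  rw [branchFactorial, branchFactorial, h, h (exponent t), exponent_joinT, Finsupp.erase_add,
    Finsupp.erase_single, zero_add, Finsupp.add_apply, Finsupp.single_eq_same, add_comm 1,
    Nat.factorial_succ]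
  push_cast
  ring

-- In the pairing where the monomials X^a are orthogonal with norm a!, multiplication by X_s is
-- adjoint to ∂/∂X_s. Hence, if `q` encodes the part of `z` in its top root degree, pruning along
-- `l` corresponds to multiplying `q` by the monomial of `l`.
open MvPolynomial in
theorem prunedFunctional_eq_coeff (hz : ∀ t, K < rootDegree t → z (single t 1) = 0)
    {q : MvPolynomial RTree ℂ}
    (hq : ∀ t, rootDegree t = K → z (single t 1) = branchFactorial t * q.coeff (exponent t))
    (l : List RTree) {t : RTree} (ht : rootDegree t = K + l.length) :
    prunedFunctional z l (single t 1) =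
      branchFactorial t * ((l.map X).prod * q).coeff (exponent t) := by
  classical
  induction l generalizing t with
  | nil => simpa [prunedFunctional] using hq t ht
  | cons s l ih =>
    rw [List.length_cons] at ht
    rw [prunedFunctional_cons, List.map_cons, List.prod_cons, mul_assoc]
    by_cases hs : s ∈ components t
    · obtain ⟨r, rfl⟩ := exists_joinT_of_mem_components hs
      rw [rootDegree_joinT] at ht
      have h := map_eq_zero_of_mem_degreeSp (f := prunedFunctional z l)
        (fun t' ht' => prunedFunctional_eq_zero hz l (by omega)) (prune_joinT_sub_mem_degreeSp s r)
      rw [map_sub, map_smul, ih (by omega), sub_eq_zero] at h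
      have hc : (components r).count s = exponent r s := by
        rw [exponent, Multiset.toFinsupp_apply]
      rw [h, branchFactorial_joinT, exponent_joinT, coeff_X_mul, smul_eq_mul, mul_assoc, hc]
    · rw [coeff_X_mul', if_neg, mul_zero]
      · exact map_eq_zero_of_mem_degreeSp
          (fun t' ht' => prunedFunctional_eq_zero hz l (by omega)) (prune_mem_degreeSp hs)
      · exact fun h => hs (mem_components_of_exponent_ne_zero (Finsupp.mem_support_iff.1 h))

end LeadingTerm

theorem prod_map_X_eq_monomial [DecidableEq RTree] (l : List RTree) :
    (l.map (MvPolynomial.X (R := ℂ))).prod =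
      MvPolynomial.monomial (Multiset.toFinsupp (l : Multiset RTree)) 1 := by
  induction l with
  | nil => simp
  | cons s l ih =>
    rw [List.map_cons, List.prod_cons, ih, ← Multiset.cons_coe, ← Multiset.singleton_add, map_add,
      Multiset.toFinsupp_singleton, MvPolynomial.X, MvPolynomial.monomial_mul, one_mul]

/-- Iterated pruning along distinct multisets of trees composed with a nonzero functional supported
on finitely many trees gives linearly independent functionals. -/
theorem exists_sum_prunedFunctional_ne_zero {z : TreeSp →ₗ[ℂ] ℂ}
    (hfin : {t | z (single t 1) ≠ 0}.Finite) (hz : z ≠ 0) (S : Finset (Multiset RTree))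
    (hS : S.Nonempty) (c : Multiset RTree → ℂ) (hc : ∀ m ∈ S, c m ≠ 0) :
    ∃ t, ∑ m ∈ S, c m * prunedFunctional z m.toList (single t 1) ≠ 0 := by
  classical
  obtain ⟨m₀, hm₀, hmax⟩ := S.exists_max_image Multiset.card hS
  have hne : hfin.toFinset.Nonempty := by
    by_contra h
    refine hz (Finsupp.lhom_ext' fun t => LinearMap.ext_ring ?_)
    by_contra h'
    exact h ⟨t, hfin.mem_toFinset.2 h'⟩
  obtain ⟨b₀, hb₀, hbmax⟩ := hfin.toFinset.exists_max_image rootDegree hne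
  have hzK : ∀ t, rootDegree b₀ < rootDegree t → z (single t 1) = 0 := by
    intro t ht
    by_contra h
    exact absurd (hbmax t (hfin.mem_toFinset.2 h)) (by omega)
  -- `q` and `p` are the top-degree parts: of `z` with respect to root degree, and of the linear
  -- combination with respect to the number of prunings.
  let q : MvPolynomial RTree ℂ := ∑ b ∈ hfin.toFinset with rootDegree b = rootDegree b₀,
    MvPolynomial.monomial (exponent b) (z (single b 1) / branchFactorial b)
  let p : MvPolynomial RTree ℂ := ∑ m ∈ S with m.card = m₀.card,
    MvPolynomial.monomial (Multiset.toFinsupp m) (c m)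
  have hqc : ∀ t, q.coeff (exponent t) =
      if rootDegree t = rootDegree b₀ then z (single t 1) / branchFactorial t else 0 := by
    intro t
    simp only [q, MvPolynomial.coeff_sum, MvPolynomial.coeff_monomial,
      exponent_injective.eq_iff]
    rw [Finset.sum_ite_eq']
    simp only [Finset.mem_filter, Set.Finite.mem_toFinset, Set.mem_ofPred_eq]
    by_cases h : z (single t 1) = 0 <;> simp [h]
  have hpc : ∀ m, p.coeff (Multiset.toFinsupp m) =
      if m ∈ S ∧ m.card = m₀.card then c m else 0 := by
    intro m
    simp only [p, MvPolynomial.coeff_sum, MvPolynomial.coeff_monomial,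
      Multiset.toFinsupp.injective.eq_iff]
    rw [Finset.sum_ite_eq']
    simp only [Finset.mem_filter]
  have hq0 : q ≠ 0 := fun h => by
    have := hqc b₀
    rw [h, if_pos rfl, MvPolynomial.coeff_zero, eq_comm, div_eq_zero_iff] at this
    exact this.elim (hfin.mem_toFinset.1 hb₀) (branchFactorial_ne_zero _)
  have hp0 : p ≠ 0 := fun h => by
    have := hpc m₀
    rw [h, if_pos ⟨hm₀, rfl⟩, MvPolynomial.coeff_zero] at this
    exact hc _ hm₀ this.symm
  -- The polynomial ring is a domain, so `p * q` has a nonzero coefficient; its monomial is the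
  -- exponent of a tree, which is the witness. As `p` and `q` are homogeneous, the root degree of
  -- that tree is forced.
  obtain ⟨n, hn⟩ := MvPolynomial.ne_zero_iff.1 (mul_ne_zero hp0 hq0)
  obtain ⟨t, rfl⟩ := exponent_surjective n
  have ht : rootDegree t = rootDegree b₀ + m₀.card := by
    rw [MvPolynomial.coeff_mul] at hn
    obtain ⟨⟨i, j⟩, hij, h⟩ := Finset.exists_ne_zero_of_sum_ne_zero hn
    obtain ⟨b, rfl⟩ := exponent_surjective j
    obtain ⟨m, rfl⟩ := Multiset.toFinsupp.surjective i
    obtain ⟨a, rfl⟩ := components_surjective m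
    have h₁ : rootDegree b = rootDegree b₀ := by
      by_contra h'
      exact h (by rw [hqc, if_neg h', mul_zero])
    have h₂ : (components a).card = m₀.card := by
      by_contra h'
      exact h (by rw [hpc, if_neg (fun h => h' h.2), zero_mul])
    rw [Finset.HasAntidiagonal.mem_antidiagonal] at hij
    have := congrArg Finsupp.degree hij
    rw [map_add, degree_exponent, degree_exponent] at this
    have h₃ := degree_exponent a
    rw [exponent] at h₃
    rw [rootDegree] at h₃
    simp only at this
    omega
  refine ⟨t, ?_⟩
  have key : ∑ m ∈ S, c m * prunedFunctional z m.toList (single t 1) =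
      branchFactorial t * (p * q).coeff (exponent t) := by
    simp only [p]
    rw [Finset.sum_mul, MvPolynomial.coeff_sum, Finset.mul_sum, Finset.sum_filter]
    refine Finset.sum_congr rfl fun m hm => ?_
    split_ifs with h
    · rw [prunedFunctional_eq_coeff hzK (q := q) ?_ _ (by rw [Multiset.length_toList, h, ht]),
        prod_map_X_eq_monomial, Multiset.coe_toList, ← mul_one (c m), ← MvPolynomial.C_mul_monomial,
        mul_assoc (MvPolynomial.C _), MvPolynomial.coeff_C_mul]
      · ring
      · intro r hr
        rw [hqc, if_pos hr, mul_div_cancel₀ _ (branchFactorial_ne_zero r)]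
    -- A multiset with fewer than `m₀.card` elements prunes too few branches to bring `t` down to
    -- the top root degree of `z`.
    · rw [prunedFunctional_eq_zero hzK, mul_zero]
      have := hmax m hm
      rw [Multiset.length_toList, ht]
      omega
  rw [key]
  exact mul_ne_zero (branchFactorial_ne_zero _) hn

/-! ### Linear families of generators -/

/-- The linear map with `single t 1 ↦ D_t^+`. -/
def plusL : TreeSp →ₗ[ℂ] InsElimAlg := linearCombination ℂ Dplus

/-- The linear map with `single t 1 ↦ D_t^-`. -/
def minusL : TreeSp →ₗ[ℂ] InsElimAlg := linearCombination ℂ Dminus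

open Classical in
theorem lie_minus_plus (s t : RTree) : ⁅Dminus s, Dplus t⁆ =
    (if s = t then dElt else 0) + (plusL (prune s t) + minusL (graftDual s t)) := by
  have h₁ : (∑ᶠ r, (alpha s t r : ℂ) • Dplus r) = ∑ᶠ r, prune s t r • Dplus r := by
    simp only [prune_apply]
  have h₂ : (∑ᶠ r, (beta s t r : ℂ) • Dminus r) = ∑ᶠ r, graftDual s t r • Dminus r := rfl
  have h : ⁅Dminus s, Dplus t⁆ = minusPlus s t := lie_basis _ _
  rw [h, minusPlus, h₁, h₂, finsum_eq_linearCombination, finsum_eq_linearCombination]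
  rfl

theorem lie_minus_minus (s t : RTree) :
    ⁅Dminus s, Dminus t⁆ = minusL (pruneDual t s - pruneDual s t) := by
  have h : ⁅Dminus s, Dminus t⁆ = ∑ᶠ r, (pruneDual t s - pruneDual s t) r • Dminus r :=
    lie_basis _ _
  rw [h, finsum_eq_linearCombination]
  rfl

theorem lie_d_plus (t : RTree) : ⁅dElt, Dplus t⁆ = (size t : ℂ) • Dplus t := lie_basis _ _

theorem lie_d_minus (t : RTree) : ⁅dElt, Dminus t⁆ = -(size t : ℂ) • Dminus t := lie_basis _ _

theorem size_of_mem_support_prune {s t r : RTree} (h : r ∈ (prune s t).support) :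
    size t = size r + size s :=
  size_eq_of_alpha_ne_zero fun h' => Finsupp.mem_support_iff.1 h (by rw [prune_apply, h']; simp)

theorem size_of_mem_support_graftDual {s t r : RTree} (h : r ∈ (graftDual s t).support) :
    size s = size r + size t :=
  size_eq_of_beta_ne_zero fun h' =>
    Finsupp.mem_support_iff.1 h (by rw [graftDual_apply, h']; simp)

theorem map_mem_of_support {M : Type*} [AddCommGroup M] [Module ℂ M] (f : TreeSp →ₗ[ℂ] M)
    (P : Submodule ℂ M) {x : TreeSp} (h : ∀ r ∈ x.support, f (single r 1) ∈ P) : f x ∈ P := by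
  rw [← Finsupp.sum_single x, Finsupp.sum, map_sum]
  refine sum_mem fun r hr => ?_
  have e : single r (x r) = x r • single r (1 : ℂ) := by simp
  rw [e, map_smul]
  exact P.smul_mem _ (h r hr)

theorem map_eq_of_support {M : Type*} [AddCommGroup M] [Module ℂ M] {f g : TreeSp →ₗ[ℂ] M}
    {x : TreeSp} (h : ∀ r ∈ x.support, f (single r 1) = g (single r 1)) : f x = g x := by
  have := map_mem_of_support (f - g) ⊥ (x := x) fun r hr => by simp [h r hr]
  rwa [Submodule.mem_bot, LinearMap.sub_apply, sub_eq_zero] at this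

/-- The total number of vertices of a list of trees. -/
def weight (l : List RTree) : ℕ := (l.map size).sum

theorem weight_cons (s : RTree) (l : List RTree) : weight (s :: l) = size s + weight l := rfl

/-- Pruning along `l` removes exactly `weight l` vertices, so only the values of `z` in one size
matter. With `z' = 0` this is the source of the vanishing statements below. -/
theorem prunedFunctional_congr {z z' : TreeSp →ₗ[ℂ] ℂ} {l : List RTree} {t : RTree}
    (h : ∀ r, size r + weight l = size t → z (single r 1) = z' (single r 1)) :
    prunedFunctional z l (single t 1) = prunedFunctional z' l (single t 1) := by
  induction l generalizing t with
  | nil => exact h t rfl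
  | cons s l ih =>
    rw [prunedFunctional_cons, prunedFunctional_cons]
    refine map_eq_of_support fun r hr => ih fun r' hr' => h r' ?_
    rw [size_of_mem_support_prune hr, weight_cons]
    omega

theorem prunedFunctional_zero (l : List RTree) : prunedFunctional 0 l = 0 := by
  induction l with
  | nil => rfl
  | cons s l ih => rw [prunedFunctional, ih, LinearMap.zero_comp]

/-! ### Representations generated by a Whittaker vector -/

section Representation

variable {V : Type*} [AddCommGroup V] [Module ℂ V] (ρ : InsElimAlg →ₗ[ℂ] Module.End ℂ V)

/-- The product of the operators `D_s^-` for `s` in a list. -/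
def word (l : List RTree) : Module.End ℂ V := (l.map fun s => ρ (Dminus s)).prod

theorem word_nil : word ρ [] = 1 := rfl

theorem word_cons (s : RTree) (l : List RTree) : word ρ (s :: l) = ρ (Dminus s) * word ρ l := by
  rw [word, List.map_cons, List.prod_cons, word]

theorem word_cons_apply (s : RTree) (l : List RTree) (v : V) :
    word ρ (s :: l) v = ρ (Dminus s) (word ρ l v) := by
  rw [word_cons, Module.End.mul_apply]

theorem map_mem_of_basis {P : Submodule ℂ V} {v : V} (h : ∀ g, ρ (genBasis g) v ∈ P)
    (x : InsElimAlg) : ρ x v ∈ P := by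
  have : x ∈ Submodule.span ℂ (Set.range genBasis) := genBasis.mem_span x
  induction this using Submodule.span_induction with
  | mem x hx =>
    obtain ⟨g, rfl⟩ := hx
    exact h g
  | zero => simp
  | add x y _ _ hx hy => rw [map_add]; exact add_mem hx hy
  | smul c x _ hx => rw [map_smul]; exact P.smul_mem _ hx

/-- The span of the vectors `D_{s₁}^- ⋯ D_{sₖ}^- d^j w` with `2 (|s₁| + ⋯ + |sₖ|) + j < n`. -/
def filtration (w : V) (n : ℕ) : Submodule ℂ V :=
  Submodule.span ℂ {v | ∃ l j, 2 * weight l + j < n ∧ v = word ρ l ((ρ dElt ^ j) w)}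

variable {ρ} {w : V}

theorem word_mem_filtration {l : List RTree} {j n : ℕ} (h : 2 * weight l + j < n) :
    word ρ l ((ρ dElt ^ j) w) ∈ filtration ρ w n :=
  Submodule.subset_span ⟨l, j, h, rfl⟩

theorem filtration_mono : Monotone (filtration ρ w) := fun m n h => by
  refine Submodule.span_mono ?_
  rintro v ⟨l, j, hl, rfl⟩
  exact ⟨l, j, by omega, rfl⟩

theorem filtration_zero : filtration ρ w 0 = ⊥ := by
  rw [eq_bot_iff, filtration, Submodule.span_le]
  rintro v ⟨l, j, h, rfl⟩
  omega

theorem map_filtration_le {f : Module.End ℂ V} {n : ℕ} {P : Submodule ℂ V}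
    (h : ∀ l j, 2 * weight l + j < n → f (word ρ l ((ρ dElt ^ j) w)) ∈ P) {v : V}
    (hv : v ∈ filtration ρ w n) : f v ∈ P := by
  have : filtration ρ w n ≤ P.comap f := by
    rw [filtration, Submodule.span_le]
    rintro v ⟨l, j, hl, rfl⟩
    exact h l j hl
  exact this hv

theorem minus_mem_filtration (s : RTree) {n : ℕ} {v : V} (hv : v ∈ filtration ρ w n) :
    ρ (Dminus s) v ∈ filtration ρ w (n + 2 * size s) := by
  refine map_filtration_le (fun l j hl => ?_) hv
  rw [← word_cons_apply]
  refine word_mem_filtration ?_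
  rw [weight_cons]
  omega

variable (hρ : ∀ x y, ρ ⁅x, y⁆ = ρ x * ρ y - ρ y * ρ x)

include hρ

theorem d_word_apply (l : List RTree) (v : V) :
    ρ dElt (word ρ l v) = word ρ l (ρ dElt v) - (weight l : ℂ) • word ρ l v := by
  induction l with
  | nil => simp [word_nil, weight]
  | cons s l ih =>
    have h := LinearMap.congr_fun (hρ dElt (Dminus s)) (word ρ l v)
    rw [lie_d_minus, map_smul] at h
    simp only [LinearMap.smul_apply, LinearMap.sub_apply, Module.End.mul_apply, ih, map_sub,
      map_smul] at h
    simp only [word_cons_apply, weight_cons]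
    push_cast
    linear_combination (norm := module) -h

theorem d_mem_filtration {n : ℕ} {v : V} (hv : v ∈ filtration ρ w n) :
    ρ dElt v ∈ filtration ρ w (n + 1) := by
  refine map_filtration_le (fun l j hl => ?_) hv
  rw [d_word_apply hρ, ← Module.End.mul_apply (ρ dElt), ← pow_succ']
  exact sub_mem (word_mem_filtration (by omega))
    (Submodule.smul_mem _ _ (word_mem_filtration (by omega)))

theorem plus_minus_apply (s t : RTree) (v : V) :
    ρ (Dplus t) (ρ (Dminus s) v) = ρ (Dminus s) (ρ (Dplus t) v) - ρ ⁅Dminus s, Dplus t⁆ v := by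
  rw [hρ]
  simp

theorem plus_d_apply (t : RTree) (v : V) :
    ρ (Dplus t) (ρ dElt v) = ρ dElt (ρ (Dplus t) v) - (size t : ℂ) • ρ (Dplus t) v := by
  have h := LinearMap.congr_fun (hρ dElt (Dplus t)) v
  rw [lie_d_plus, map_smul] at h
  simp only [LinearMap.smul_apply, LinearMap.sub_apply, Module.End.mul_apply] at h
  rw [h]
  abel

variable {e : TreeSp →ₗ[ℂ] ℂ} (hw : ∀ t, ρ (Dplus t) w = e (single t 1) • w)

include hw

theorem plus_pow_d_sub_mem (t : RTree) (j : ℕ) :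
    ρ (Dplus t) ((ρ dElt ^ j) w) - e (single t 1) • (ρ dElt ^ j) w ∈ filtration ρ w j := by
  induction j with
  | zero => simp [hw]
  | succ j ih =>
    have h₁ := d_mem_filtration hρ ih
    have h₂ : (ρ dElt ^ j) w ∈ filtration ρ w (j + 1) :=
      word_mem_filtration (l := []) (by simp [weight])
    have h₃ := add_mem (filtration_mono (Nat.le_succ j) ih) (Submodule.smul_mem _ (e (single t 1)) h₂)
    rw [sub_add_cancel] at h₃
    rw [pow_succ', Module.End.mul_apply, plus_d_apply hρ]
    convert sub_mem h₁ (Submodule.smul_mem _ (size t : ℂ) h₃) using 1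
    rw [map_sub, map_smul]
    abel

/-- The word itself lies one level higher. Commuting D_t⁺ past D_s⁻ gives D_r⁺, D_r⁻ with |r| < |s|,
or d. Each loses at least one level: D_s⁻ is worth 2|s| ≥ 2 and d only 1, which is why weights are
doubled in `filtration`. -/
theorem plus_word_sub_mem (l : List RTree) (j : ℕ) (t : RTree) :
    ρ (Dplus t) (word ρ l ((ρ dElt ^ j) w)) - e (single t 1) • word ρ l ((ρ dElt ^ j) w) ∈
      filtration ρ w (2 * weight l + j) := by
  classical
  induction l generalizing t with
  | nil =>
    have := plus_pow_d_sub_mem hρ hw t j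
    simpa [word_nil, weight] using this
  | cons s l ih =>
    set u := word ρ l ((ρ dElt ^ j) w) with hu
    have hs := size_pos s
    have ht := size_pos t
    have hu' : u ∈ filtration ρ w (2 * weight l + j + 1) := word_mem_filtration (by omega)
    have hp : ∀ r, ρ (Dplus r) u ∈ filtration ρ w (2 * weight l + j + 1) := fun r => by
      have := add_mem (filtration_mono (Nat.le_succ _) (ih r))
        (Submodule.smul_mem _ (e (single r 1)) hu')
      rwa [sub_add_cancel] at this
    have h₀ : ρ (Dminus s) (ρ (Dplus t) u - e (single t 1) • u) ∈
        filtration ρ w (2 * weight (s :: l) + j) :=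
      filtration_mono (by rw [weight_cons]; omega) (minus_mem_filtration s (ih t))
    have h₁ : ρ (if s = t then dElt else 0) u ∈ filtration ρ w (2 * weight (s :: l) + j) := by
      split_ifs
      · exact filtration_mono (by rw [weight_cons]; omega) (d_mem_filtration hρ hu')
      · simp
    have h₂ : ρ (plusL (prune s t)) u ∈ filtration ρ w (2 * weight (s :: l) + j) := by
      refine map_mem_of_support ((ρ.flip u).comp plusL) _ fun r _ => ?_
      simp only [LinearMap.comp_apply, LinearMap.flip_apply, plusL, linearCombination_single,
        one_smul]
      exact filtration_mono (by rw [weight_cons]; omega) (hp r)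
    have h₃ : ρ (minusL (graftDual s t)) u ∈ filtration ρ w (2 * weight (s :: l) + j) := by
      refine map_mem_of_support ((ρ.flip u).comp minusL) _ fun r hr => ?_
      have := size_of_mem_support_graftDual hr
      simp only [LinearMap.comp_apply, LinearMap.flip_apply, minusL, linearCombination_single,
        one_smul]
      exact filtration_mono (by rw [weight_cons]; omega) (minus_mem_filtration r hu')
    rw [word_cons_apply, ← hu, plus_minus_apply hρ, lie_minus_plus]
    convert sub_mem h₀ (add_mem h₁ (add_mem h₂ h₃)) using 1
    simp only [map_sub, map_add, map_smul, LinearMap.add_apply]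
    abel

theorem plus_sub_mem_filtration {n : ℕ} {v : V} (hv : v ∈ filtration ρ w (n + 1)) (t : RTree) :
    ρ (Dplus t) v - e (single t 1) • v ∈ filtration ρ w n := by
  refine map_filtration_le (f := ρ (Dplus t) - e (single t 1) • 1) (fun l j hl => ?_) hv
  exact filtration_mono (by omega) (plus_word_sub_mem hρ hw l j t)

variable (hgen : ∀ P : Submodule ℂ V, w ∈ P → (∀ x, ∀ v ∈ P, ρ x v ∈ P) → P = ⊤)

include hgen

/-- The union of the filtration contains w and is stable under all generators: d and D_s⁻ raise the
level by a bounded amount, and D_t⁺ does not raise it. -/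
theorem exists_mem_filtration (v : V) : ∃ n, v ∈ filtration ρ w n := by
  rw [← Submodule.mem_iSup_of_directed _ filtration_mono.directed_le]
  have : (⨆ n, filtration ρ w n) = ⊤ := by
    refine hgen _ ?_ fun x v hv => ?_
    · exact Submodule.mem_iSup_of_mem 1 (word_mem_filtration (l := []) (j := 0) (by simp [weight]))
    · rw [Submodule.mem_iSup_of_directed _ filtration_mono.directed_le] at hv
      obtain ⟨n, hv⟩ := hv
      refine map_mem_of_basis ρ (fun g => ?_) x
      cases g with
      | d => exact Submodule.mem_iSup_of_mem _ (d_mem_filtration hρ hv)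
      | minus s => exact Submodule.mem_iSup_of_mem _ (minus_mem_filtration s hv)
      | plus t =>
        have h := add_mem
          (plus_sub_mem_filtration hρ hw (filtration_mono (Nat.le_succ n) hv) t)
          (Submodule.smul_mem _ (e (single t 1)) hv)
        rw [sub_add_cancel] at h
        exact Submodule.mem_iSup_of_mem _ h
  rw [this]
  trivial

/-- A nonzero invariant subspace contains a nonzero Whittaker vector. -/
theorem exists_whittaker_mem {P : Submodule ℂ V} (hP : P ≠ ⊥) (hinv : ∀ x, ∀ v ∈ P, ρ x v ∈ P) :
    ∃ v ∈ P, v ≠ 0 ∧ ∀ t, ρ (Dplus t) v = e (single t 1) • v := by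
  classical
  obtain ⟨v₀, hv₀, h₀⟩ := P.ne_bot_iff.1 hP
  have hex : ∃ n, ∃ v ∈ P, v ≠ 0 ∧ v ∈ filtration ρ w n := by
    obtain ⟨n, hn⟩ := exists_mem_filtration hρ hw hgen v₀
    exact ⟨n, v₀, hv₀, h₀, hn⟩
  obtain ⟨v, hv, hv0, hvn⟩ := Nat.find_spec hex
  cases hn : Nat.find hex with
  | zero =>
    rw [hn, filtration_zero, Submodule.mem_bot] at hvn
    exact absurd hvn hv0
  | succ n =>
    rw [hn] at hvn
    refine ⟨v, hv, hv0, fun t => ?_⟩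
    by_contra h
    -- Otherwise `ρ (Dplus t) v - e (single t 1) • v` would be a nonzero vector of `P` at a lower
    -- level, against the minimality of the level of `v`.
    refine Nat.find_min hex (m := n) (by omega) ⟨_, sub_mem (hinv (Dplus t) v hv)
      (P.smul_mem (e (single t 1)) hv), sub_ne_zero.2 h, plus_sub_mem_filtration hρ hw hvn t⟩

end Representation

/-! ### Ordered spanning vectors and uniqueness of the Whittaker vector -/

/-- A polynomial with period a takes the value p(0) at every multiple n·a, hence infinitely often.
-/
theorem exists_eq_C_of_taylor_eq {a : ℂ} (ha : a ≠ 0) {p : Polynomial ℂ}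
    (h : Polynomial.taylor a p = p) : ∃ c, p = Polynomial.C c := by
  refine ⟨p.eval 0, Polynomial.eq_of_infinite_eval_eq _ _ ?_⟩
  have hinj : Function.Injective fun n : ℕ => (n : ℂ) * a := fun m n hmn =>
    Nat.cast_injective (mul_right_cancel₀ ha hmn)
  refine (Set.infinite_range_of_injective hinj).mono ?_
  rintro _ ⟨n, rfl⟩
  simp only [Set.mem_ofPred_eq, Polynomial.eval_C]
  induction n with
  | zero => simp
  | succ n ih =>
    have := Polynomial.taylor_eval a p (n * a)
    rw [h] at this
    rw [← ih, this]
    congr 1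
    push_cast
    ring

section Representation

variable {V : Type*} [AddCommGroup V] [Module ℂ V] (ρ : InsElimAlg →ₗ[ℂ] Module.End ℂ V)

/-- The linear map sending a polynomial `p` to `p(d) w`. -/
def polyAct (w : V) : Polynomial ℂ →ₗ[ℂ] V :=
  ((LinearMap.id : Module.End ℂ V →ₗ[ℂ] Module.End ℂ V).flip w).comp
    (Polynomial.aeval (ρ dElt)).toLinearMap

theorem polyAct_apply (w : V) (p : Polynomial ℂ) :
    polyAct ρ w p = Polynomial.aeval (ρ dElt) p w := rfl

theorem polyAct_X_mul (w : V) (p : Polynomial ℂ) :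
    polyAct ρ w (Polynomial.X * p) = ρ dElt (polyAct ρ w p) := by
  rw [polyAct_apply, map_mul, Polynomial.aeval_X, Module.End.mul_apply, polyAct_apply]

theorem polyAct_C (w : V) (c : ℂ) : polyAct ρ w (Polynomial.C c) = c • w := by
  rw [polyAct_apply, Polynomial.aeval_C, Module.algebraMap_end_apply]

theorem polyAct_X_pow (w : V) (j : ℕ) : polyAct ρ w (Polynomial.X ^ j) = (ρ dElt ^ j) w := by
  rw [polyAct_apply, map_pow, Polynomial.aeval_X]

/-- The linear map sending `m ↦ p` to `D_{s₁}^- ⋯ D_{sₖ}^- p(d) w`, where `s₁, …, sₖ` are the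
elements of `m` in a chosen order. -/
def orderedAct (w : V) : (Multiset RTree →₀ Polynomial ℂ) →ₗ[ℂ] V :=
  Finsupp.lsum ℂ fun m => (word ρ m.toList).comp (polyAct ρ w)

theorem orderedAct_single (w : V) (m : Multiset RTree) (p : Polynomial ℂ) :
    orderedAct ρ w (single m p) = word ρ m.toList (polyAct ρ w p) := by
  simp [orderedAct]

/-- The span of the products of fewer than `k` operators `D_s^-`. -/
def shortWords (k : ℕ) : Submodule ℂ (Module.End ℂ V) :=
  Submodule.span ℂ {f | ∃ l : List RTree, l.length < k ∧ f = word ρ l}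

variable {ρ} {w : V}

theorem minus_mul_mem_shortWords (s : RTree) {k : ℕ} {f : Module.End ℂ V}
    (hf : f ∈ shortWords ρ k) : ρ (Dminus s) * f ∈ shortWords ρ (k + 1) := by
  have : shortWords ρ k ≤ (shortWords ρ (k + 1)).comap (LinearMap.mulLeft ℂ (ρ (Dminus s))) := by
    rw [shortWords, Submodule.span_le]
    rintro f ⟨l, hl, rfl⟩
    exact Submodule.subset_span ⟨s :: l, by simpa using hl, (word_cons ρ s l).symm⟩
  exact this hf

variable (hρ : ∀ x y, ρ ⁅x, y⁆ = ρ x * ρ y - ρ y * ρ x)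

include hρ

/-- Exchanging two neighbours costs a commutator, which is a combination of single operators D_r⁻,
hence of shorter words. -/
theorem word_sub_mem_of_perm {l l' : List RTree} (h : l.Perm l') :
    word ρ l - word ρ l' ∈ shortWords ρ l.length := by
  induction h with
  | nil => simp
  | cons a _ ih =>
    rw [word_cons, word_cons, ← mul_sub]
    exact minus_mul_mem_shortWords a ih
  | swap a b l =>
    have h : word ρ (b :: a :: l) - word ρ (a :: b :: l) =
        ρ (minusL (pruneDual a b - pruneDual b a)) * word ρ l := by
      rw [← lie_minus_minus, hρ]
      simp only [word_cons]
      noncomm_ring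
    rw [h]
    refine map_mem_of_support (((LinearMap.mulRight ℂ (word ρ l)).comp ρ).comp minusL) _
      fun r _ => ?_
    simp only [LinearMap.comp_apply, minusL, linearCombination_single, one_smul,
      LinearMap.mulRight_apply]
    exact Submodule.subset_span ⟨r :: l, by simp, (word_cons ρ r l).symm⟩
  | trans h₁ h₂ ih₁ ih₂ =>
    rw [← h₁.length_eq] at ih₂
    have := add_mem ih₁ ih₂
    rwa [sub_add_sub_cancel] at this

theorem word_polyAct_mem_range (l : List RTree) (p : Polynomial ℂ) :
    word ρ l (polyAct ρ w p) ∈ LinearMap.range (orderedAct ρ w) := by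
  induction hn : l.length using Nat.strong_induction_on generalizing l with
  | _ n ih =>
    have h₁ : ∀ f ∈ shortWords ρ l.length,
        f (polyAct ρ w p) ∈ LinearMap.range (orderedAct ρ w) := by
      intro f hf
      have : shortWords ρ l.length ≤ (LinearMap.range (orderedAct ρ w)).comap
          ((LinearMap.id : Module.End ℂ V →ₗ[ℂ] Module.End ℂ V).flip (polyAct ρ w p)) := by
        rw [shortWords, Submodule.span_le]
        rintro f ⟨l', hl', rfl⟩
        exact ih _ (hn ▸ hl') l' rfl
      exact this hf
    have hperm : l.Perm (l : Multiset RTree).toList := by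
      rw [← Multiset.coe_eq_coe, Multiset.coe_toList]
    have h₂ := h₁ _ (word_sub_mem_of_perm hρ hperm)
    have h₃ : word ρ (l : Multiset RTree).toList (polyAct ρ w p) ∈
        LinearMap.range (orderedAct ρ w) := ⟨_, orderedAct_single ρ w _ p⟩
    have := add_mem h₂ h₃
    rwa [LinearMap.sub_apply, sub_add_cancel] at this

variable {e : TreeSp →ₗ[ℂ] ℂ} (hw : ∀ t, ρ (Dplus t) w = e (single t 1) • w)

include hw

/-- The relation D_t⁺ d = (d − |t|) D_t⁺ moves D_t⁺ past p(d), turning it into p(d − |t|). -/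
theorem plus_polyAct (t : RTree) (p : Polynomial ℂ) :
    ρ (Dplus t) (polyAct ρ w p) =
      e (single t 1) • polyAct ρ w (Polynomial.taylor (-(size t : ℂ)) p) := by
  induction p using Polynomial.induction_on' with
  | add p q hp hq => simp only [map_add, hp, hq, smul_add]
  | monomial n c =>
    induction n with
    | zero =>
      rw [Polynomial.monomial_zero_left, Polynomial.taylor_C, polyAct_C, map_smul, hw, smul_comm]
    | succ n ih =>
      rw [← Polynomial.X_mul_monomial, polyAct_X_mul, plus_d_apply hρ, ih, Polynomial.taylor_mul,
        Polynomial.taylor_X, add_mul, map_add, polyAct_X_mul, map_smul, ← Polynomial.smul_eq_C_mul,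
        map_smul]
      module

/-- For t this large, commuting D_t⁺ past D_s⁻ leaves only the pruning term. The product D_s⁻ D_t⁺
contributes zero, because after the other prunings more than N vertices remain; no tree grafted with
t can give s, as |t| > |s|; and d does not occur, as s ≠ t. The shift is by N, not |t|, since at the
end only trees of size N survive. -/
theorem plus_word_polyAct {N : ℕ} (hN : 0 < N) (heN : ∀ t, N < size t → e (single t 1) = 0)
    (l : List RTree) {t : RTree} (ht : N + weight l ≤ size t) (p : Polynomial ℂ) :
    ρ (Dplus t) (word ρ l (polyAct ρ w p)) =
      ((-1) ^ l.length * prunedFunctional e l (single t 1)) •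
        polyAct ρ w (Polynomial.taylor (-(N : ℂ)) p) := by
  classical
  induction l generalizing t with
  | nil =>
    simp only [weight, List.map_nil, List.sum_nil, add_zero] at ht
    simp only [word_nil, Module.End.one_apply, List.length_nil, pow_zero, one_mul,
      prunedFunctional]
    rw [plus_polyAct hρ hw]
    rcases ht.eq_or_lt with rfl | ht
    · rfl
    · rw [heN t ht, zero_smul, zero_smul]
  | cons s l ih =>
    rw [weight_cons] at ht
    have hs := size_pos s
    have h₀ : prunedFunctional e l (single t 1) = 0 := by
      rw [prunedFunctional_congr (z' := 0), prunedFunctional_zero, LinearMap.zero_apply]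
      intro r hr
      rw [heN r (by omega), LinearMap.zero_apply]
    have h₁ : graftDual s t = 0 := by
      by_contra h
      obtain ⟨r, hr⟩ := Finsupp.support_nonempty_iff.2 h
      have := size_of_mem_support_graftDual hr
      omega
    have h₂ : s ≠ t := by
      rintro rfl
      omega
    set u := word ρ l (polyAct ρ w p)
    set v := polyAct ρ w (Polynomial.taylor (-(N : ℂ)) p)
    have h₃ : ρ (plusL (prune s t)) u =
        ((-1) ^ l.length * prunedFunctional e l (prune s t)) • v := by
      refine map_eq_of_support (f := (ρ.flip u).comp plusL)
        (g := ((-1 : ℂ) ^ l.length • prunedFunctional e l).smulRight v) fun r hr => ?_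
      have := size_of_mem_support_prune hr
      simp only [LinearMap.comp_apply, LinearMap.flip_apply, plusL, linearCombination_single,
        one_smul, LinearMap.smulRight_apply, LinearMap.smul_apply, smul_eq_mul]
      exact ih (by omega)
    rw [word_cons_apply, plus_minus_apply hρ, lie_minus_plus, ih (by omega), h₀, h₁, if_neg h₂,
      map_zero, add_zero, zero_add, h₃, prunedFunctional_cons, List.length_cons, pow_succ]
    simp

/-- The vectors `d^j w` are linearly independent. -/
theorem polyAct_injective {N : ℕ} {t : RTree} (ht : size t = N) (hN : 0 < N)
    (het : e (single t 1) ≠ 0) (hw0 : w ≠ 0) : Function.Injective (polyAct ρ w) := by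
  rw [injective_iff_map_eq_zero]
  intro p hp
  induction hn : p.natDegree using Nat.strong_induction_on generalizing p with
  | _ n ih =>
    by_contra hp0
    -- Applying D_t⁺ to p(d) w = 0 gives p(d − N) w = 0. The difference q has smaller degree and
    -- also annihilates w, so it vanishes by induction; then p is constant.
    set q := Polynomial.taylor (-(N : ℂ)) p - p with hq
    have hq1 : polyAct ρ w q = 0 := by
      have h := plus_polyAct hρ hw t p
      rw [hp, map_zero, ht] at h
      rw [hq, map_sub, hp, sub_zero]
      exact (smul_eq_zero.1 h.symm).resolve_left het
    have hlt : q.degree < p.degree := by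
      rw [← Polynomial.degree_taylor p (-(N : ℂ))]
      refine Polynomial.degree_sub_lt_left (Polynomial.degree_taylor _ _) ?_ ?_
      · rwa [Ne, Polynomial.taylor_eq_zero]
      · exact Polynomial.leadingCoeff_taylor _ _
    have hq0 : q = 0 := by
      by_contra h
      exact h (ih _ (hn ▸ Polynomial.natDegree_lt_natDegree h hlt) q hq1 rfl)
    obtain ⟨c, rfl⟩ := exists_eq_C_of_taylor_eq
      (neg_ne_zero.2 (Nat.cast_ne_zero.2 hN.ne')) (sub_eq_zero.1 hq0)
    rw [polyAct_C, smul_eq_zero] at hp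
    exact hp0 (by rw [hp.resolve_right hw0, Polynomial.C_0])

variable (hgen : ∀ P : Submodule ℂ V, w ∈ P → (∀ x, ∀ v ∈ P, ρ x v ∈ P) → P = ⊤)

include hgen

theorem orderedAct_surjective : Function.Surjective (orderedAct ρ w) := by
  intro v
  obtain ⟨n, hn⟩ := exists_mem_filtration hρ hw hgen v
  refine map_filtration_le (f := 1) (P := LinearMap.range (orderedAct ρ w)) (fun l j _ => ?_) hn
  rw [Module.End.one_apply, ← polyAct_X_pow]
  exact word_polyAct_mem_range hρ l _

/-- The Whittaker vectors of a representation generated by a nonzero Whittaker vector whose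
character is nonzero and has finite support. -/
theorem eq_smul_of_whittaker (hw0 : w ≠ 0) (he0 : ∃ t, e (single t 1) ≠ 0)
    (hefin : ∃ M, ∀ t, M ≤ size t → e (single t 1) = 0) {v : V}
    (hv : ∀ t, ρ (Dplus t) v = e (single t 1) • v) : ∃ c : ℂ, v = c • w := by
  classical
  -- N is the largest size on which the character is nonzero; it exists because there are finitely
  -- many trees of bounded size.
  obtain ⟨N, t₀, ht₀, het₀, heN⟩ :
      ∃ N t₀, size t₀ = N ∧ e (single t₀ 1) ≠ 0 ∧ ∀ t, N < size t → e (single t 1) = 0 := by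
    obtain ⟨M, hM⟩ := hefin
    obtain ⟨t₁, ht₁⟩ := he0
    have hfin : {t | e (single t 1) ≠ 0}.Finite := (finite_size_le M).subset fun t ht => by
      by_contra h
      exact ht (hM t (not_le.1 h).le)
    obtain ⟨t₀, h₀, hmax⟩ := hfin.exists_maximalFor size _ ⟨t₁, ht₁⟩
    refine ⟨_, t₀, rfl, h₀, fun t ht => ?_⟩
    by_contra h
    have := hmax h ht.le
    omega
  have hN : 0 < N := ht₀ ▸ size_pos t₀
  have hinj := polyAct_injective hρ hw ht₀ hN het₀ hw0
  obtain ⟨f, rfl⟩ := orderedAct_surjective hρ hw hgen v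
  -- No word with a factor D_s⁻ occurs. Otherwise the largest weight W is positive, so the character
  -- vanishes on trees of size N + W, and their D_t⁺ kills the vector.
  have hf : ∀ m ∈ f.support, m = 0 := by
    by_contra! hne
    obtain ⟨m₁, hm₁, hm₁0⟩ := hne
    obtain ⟨m₀, hm₀, hmax⟩ := f.support.exists_max_image (fun m => weight m.toList) ⟨m₁, hm₁⟩
    have hpos : 0 < weight m₀.toList := by
      refine lt_of_lt_of_le ?_ (hmax m₁ hm₁)
      obtain ⟨s, hs⟩ := Multiset.exists_mem_of_ne_zero hm₁0
      rw [← Multiset.mem_toList] at hs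
      exact (size_pos s).trans_le (List.single_le_sum (fun _ _ => Nat.zero_le _) _
        (List.mem_map_of_mem (f := size) hs))
    set W := weight m₀.toList
    obtain ⟨j, hj⟩ : ∃ j, (f m₀).coeff j ≠ 0 := by
      by_contra! h
      exact Finsupp.mem_support_iff.1 hm₀ (Polynomial.ext h)
    -- The d^j w are independent, so the relation produced by D_t⁺ holds for each coefficient j
    -- separately.
    have key : ∀ t, size t = N + W → ∑ m ∈ f.support,
        (-1) ^ m.toList.length * (f m).coeff j * prunedFunctional e m.toList (single t 1) = 0 := by
      intro t ht
      have h₁ := hv t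
      rw [heN t (by omega), zero_smul, orderedAct, Finsupp.lsum_apply, Finsupp.sum, map_sum] at h₁
      have h₂ : polyAct ρ w (Polynomial.taylor (-(N : ℂ)) (∑ m ∈ f.support,
          ((-1) ^ m.toList.length * prunedFunctional e m.toList (single t 1)) • f m)) = 0 := by
        rw [← h₁, map_sum, map_sum]
        refine Finset.sum_congr rfl fun m hm => ?_
        have := hmax m hm
        rw [LinearMap.comp_apply, plus_word_polyAct hρ hw hN heN _ (by omega), map_smul, map_smul]
      rw [map_eq_zero_iff _ hinj, Polynomial.taylor_eq_zero] at h₂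
      have h₃ := congrArg (fun p => Polynomial.coeff p j) h₂
      simp only [Polynomial.finsetSum_coeff, Polynomial.coeff_smul, smul_eq_mul,
        Polynomial.coeff_zero] at h₃
      rw [← h₃]
      exact Finset.sum_congr rfl fun m _ => by ring
    -- Cutting the character down to size N makes the relations hold for all trees: for words of
    -- weight W the pruned functional is unchanged at size N + W and zero at other sizes. Words of
    -- smaller weight contribute nothing at size N + W, since pruning leaves more than N vertices.
    let z : TreeSp →ₗ[ℂ] ℂ := linearCombination ℂ fun t =>
      if size t = N then e (single t 1) else 0
    have hz : ∀ t, z (single t 1) = if size t = N then e (single t 1) else 0 := fun t => by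
      simp [z]
    let S := f.support.filter fun m => weight m.toList = W ∧ (f m).coeff j ≠ 0
    obtain ⟨t, ht⟩ := exists_sum_prunedFunctional_ne_zero (z := z)
      ((finite_size_le N).subset fun t (ht : z (single t 1) ≠ 0) => by
        by_contra h
        have h' : size t ≠ N := fun h' => h h'.le
        exact ht (by rw [hz, if_neg h']))
      (fun h => het₀ (by
        have := hz t₀
        rwa [h, if_pos ht₀, LinearMap.zero_apply, eq_comm] at this))
      S ⟨m₀, by simp [S, hm₀, hj, W, -Finsupp.mem_support_iff]⟩
      (fun m => (-1) ^ m.toList.length * (f m).coeff j)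
      (fun m hm => mul_ne_zero (pow_ne_zero _ (by norm_num)) (Finset.mem_filter.1 hm).2.2)
    refine ht ?_
    by_cases hsize : size t = N + W
    · rw [← key t hsize, Finset.sum_filter]
      refine Finset.sum_congr rfl fun m hm => ?_
      have hle := hmax m hm
      by_cases hc : (f m).coeff j = 0
      · simp [hc]
      by_cases hW : weight m.toList = W
      · rw [if_pos ⟨hW, hc⟩, prunedFunctional_congr (z' := e)]
        intro r hr
        rw [hz, if_pos (by omega)]
      · rw [if_neg fun h => hW h.1, prunedFunctional_congr (z := e) (z' := 0),
          prunedFunctional_zero, LinearMap.zero_apply, mul_zero]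
        intro r hr
        rw [LinearMap.zero_apply, heN]
        omega
    · refine Finset.sum_eq_zero fun m hm => ?_
      have hW := (Finset.mem_filter.1 hm).2.1
      rw [prunedFunctional_congr (z' := 0), prunedFunctional_zero, LinearMap.zero_apply, mul_zero]
      intro r hr
      rw [hz, if_neg (by omega), LinearMap.zero_apply]
  have hf0 : f = single 0 (f 0) := by
    ext1 m
    by_cases hm : m = 0
    · rw [hm, Finsupp.single_eq_same]
    · rw [Finsupp.single_eq_of_ne hm]
      by_contra h
      exact hm (hf m (Finsupp.mem_support_iff.2 h))
  have hv₀ := hv t₀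
  rw [hf0, orderedAct_single, Multiset.toList_zero, word_nil, Module.End.one_apply] at hv₀ ⊢
  rw [plus_polyAct hρ hw, ht₀] at hv₀
  -- What remains is p(d) w; the Whittaker condition at `t₀` reads p(d − N) w = p(d) w, so p has a
  -- nonzero period.
  have := hinj (smul_right_injective V het₀ hv₀)
  obtain ⟨c, hc⟩ := exists_eq_C_of_taylor_eq (neg_ne_zero.2 (Nat.cast_ne_zero.2 hN.ne')) this
  exact ⟨c, by rw [hc, polyAct_C]⟩

end Representation

/-! ### The standard Whittaker module -/

section StdWhittaker

variable (η : LieAlgebra.LieCharacter ℂ nPlus)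

/-- The character `η` as a functional on the span of the trees. -/
def charL : TreeSp →ₗ[ℂ] ℂ := linearCombination ℂ fun t => η (nPlusD t)

theorem charL_single (t : RTree) : charL η (single t 1) = η (nPlusD t) := by
  simp [charL]

theorem coe_linearCombination_nPlusD (x : TreeSp) :
    ((linearCombination ℂ nPlusD x : nPlus) : InsElimAlg) = plusL x := by
  induction x using Finsupp.induction_linear with
  | zero => simp
  | add x y hx hy => rw [map_add, map_add, ← hx, ← hy]; rfl
  | single t c => rw [plusL, linearCombination_single, linearCombination_single]; rfl

theorem charL_eq (x : TreeSp) : charL η x = η (linearCombination ℂ nPlusD x) := by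
  induction x using Finsupp.induction_linear with
  | zero => simp
  | add x y hx hy => rw [map_add, map_add, map_add, hx, hy]
  | single t c => rw [charL, linearCombination_single, linearCombination_single, map_smul]

theorem exists_eq_linearCombination_nPlusD (x : nPlus) :
    ∃ y : TreeSp, x = linearCombination ℂ nPlusD y := by
  obtain ⟨y, hy⟩ := Finsupp.mem_span_range_iff_exists_finsupp.1
    (show (x : InsElimAlg) ∈ Submodule.span ℂ (Set.range Dplus) from x.2)
  refine ⟨y, Subtype.ext ?_⟩
  rw [coe_linearCombination_nPlusD, ← hy]
  rfl

theorem lie_nPlusD (s t : RTree) :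
    ⁅nPlusD s, nPlusD t⁆ = linearCombination ℂ nPlusD (graft s t - graft t s) := by
  refine Subtype.ext ?_
  rw [coe_linearCombination_nPlusD]
  have h : ⁅Dplus s, Dplus t⁆ = ∑ᶠ r, (graft s t - graft t s) r • Dplus r := by
    rw [lie_plus_plus]
    simp only [Finsupp.sub_apply, graft_apply]
  rw [finsum_eq_linearCombination] at h
  exact h

/-- A Lie homomorphism to ℂ kills brackets, and the bracket of two D⁺ is the difference of the two
graftings. -/
theorem charL_graftL_comm (x y : TreeSp) : charL η (graftL x y) = charL η (graftL y x) := by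
  induction x using Finsupp.induction_linear with
  | zero => simp
  | add x x' h h' => simp only [map_add, LinearMap.add_apply, h, h']
  | single s c =>
  induction y using Finsupp.induction_linear with
  | zero => simp
  | add y y' h h' => simp only [map_add, LinearMap.add_apply, h, h']
  | single t c' =>
    have e : ∀ (t : RTree) (c : ℂ), single t c = c • single t (1 : ℂ) := by simp
    have g : ∀ a b, graftL (single a 1) (single b 1) = graft a b := by simp [graftL]
    have h : charL η (graft s t) = charL η (graft t s) := by
      rw [← sub_eq_zero, ← map_sub, charL_eq, ← lie_nPlusD, LieAlgebra.lieCharacter_apply_lie]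
    rw [e s, e t]
    simp only [map_smul, LinearMap.smul_apply, g, h, smul_eq_mul]
    ring

-- Enveloping algebras and the cyclic vector of M_η

attribute [local instance] LieRing.ofAssociativeRing

theorem exists_nPlusD_ne_zero (hη : η ≠ 0) : ∃ t, η (nPlusD t) ≠ 0 := by
  by_contra! h
  refine hη (LieHom.ext fun x => ?_)
  obtain ⟨y, rfl⟩ := exists_eq_linearCombination_nPlusD x
  rw [← charL_eq, charL, linearCombination_apply, Finsupp.sum]
  simp [h]

/-- By the universal property the enveloping algebra maps to S, and composing with the inclusion of
S gives the identity. -/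
theorem envelope_subalgebra_eq_top {L : Type*} [LieRing L] [LieAlgebra ℂ L]
    (S : Subalgebra ℂ (UniversalEnvelopingAlgebra ℂ L))
    (h : ∀ x, UniversalEnvelopingAlgebra.ι ℂ x ∈ S) : S = ⊤ := by
  let f : L →ₗ⁅ℂ⁆ S :=
    { toFun := fun x => ⟨UniversalEnvelopingAlgebra.ι ℂ x, h x⟩
      map_add' := fun x y => Subtype.ext (map_add _ x y)
      map_smul' := fun c x => Subtype.ext (map_smul _ c x)
      map_lie' := fun {x y} => Subtype.ext (LieHom.map_lie _ x y) }
  have hf : S.val.comp (UniversalEnvelopingAlgebra.lift ℂ f) = AlgHom.id ℂ _ := by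
    refine UniversalEnvelopingAlgebra.hom_ext ℂ (LieHom.ext fun x => ?_)
    change ((UniversalEnvelopingAlgebra.lift ℂ f (UniversalEnvelopingAlgebra.ι ℂ x) : S) :
      UniversalEnvelopingAlgebra ℂ L) = UniversalEnvelopingAlgebra.ι ℂ x
    rw [UniversalEnvelopingAlgebra.lift_ι_apply]
    rfl
  rw [eq_top_iff]
  intro u _
  have := AlgHom.congr_fun hf u
  rw [AlgHom.id_apply] at this
  rw [← this]
  exact (UniversalEnvelopingAlgebra.lift ℂ f u).2

theorem envelope_smul_mem {L M : Type*} [LieRing L] [LieAlgebra ℂ L] [AddCommGroup M] [Module ℂ M]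
    [Module (UniversalEnvelopingAlgebra ℂ L) M]
    [IsScalarTower ℂ (UniversalEnvelopingAlgebra ℂ L) M] (P : Submodule ℂ M)
    (h : ∀ x : L, ∀ v ∈ P, UniversalEnvelopingAlgebra.ι ℂ x • v ∈ P)
    (u : UniversalEnvelopingAlgebra ℂ L) {v : M} (hv : v ∈ P) : u • v ∈ P := by
  let S : Subalgebra ℂ (UniversalEnvelopingAlgebra ℂ L) :=
    { carrier := {u | ∀ v ∈ P, u • v ∈ P}
      mul_mem' := fun {a b} ha hb v hv => by rw [mul_smul]; exact ha _ (hb v hv)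
      add_mem' := fun {a b} ha hb v hv => by rw [add_smul]; exact add_mem (ha v hv) (hb v hv)
      algebraMap_mem' := fun c v hv => by rw [algebraMap_smul]; exact P.smul_mem c hv }
  have : u ∈ S := by
    rw [envelope_subalgebra_eq_top S h]
    trivial
  exact this v hv

/-- The action of the insertion-elimination algebra on the dual of `TreeSp`. -/
def dualAct : InsElimAlg →ₗ⁅ℂ⁆ Module.End ℂ (Module.Dual ℂ TreeSp) where
  toLinearMap := -(Module.Dual.transpose.comp treeAct)
  map_lie' {x y} := by
    refine LinearMap.ext fun l => LinearMap.ext fun v => ?_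
    have h : treeAct ⁅x, y⁆ = treeAct x * treeAct y - treeAct y * treeAct x :=
      (treeAct_bracket x y).trans (Ring.lie_def _ _)
    change -(l (treeAct ⁅x, y⁆ v)) = -((-(l ∘ₗ treeAct y)) (treeAct x v)) -
      -((-(l ∘ₗ treeAct x)) (treeAct y v))
    rw [h]
    simp only [LinearMap.sub_apply, Module.End.mul_apply, map_sub, LinearMap.neg_apply,
      LinearMap.comp_apply]
    ring

theorem dualAct_apply (x : InsElimAlg) (l : Module.Dual ℂ TreeSp) (v : TreeSp) :
    dualAct x l v = -l (treeAct x v) := rfl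

theorem exists_dual_whittaker : ∃ l : Module.Dual ℂ TreeSp, l ≠ 0 ∧
    ∀ x : nPlus, dualAct x l = η x • l := by
  -- The sign compensates for the one in the dual action.
  obtain ⟨l, hl, h⟩ := exists_eigenfunctional (-charL η) fun x y => by
    rw [LinearMap.neg_apply, LinearMap.neg_apply, charL_graftL_comm]
  refine ⟨l, hl, fun x => LinearMap.ext fun v => ?_⟩
  obtain ⟨y, rfl⟩ := exists_eq_linearCombination_nPlusD x
  have hy : treeAct (plusL y) = graftL y := by
    rw [← treeAct_sum_plus, finsum_eq_linearCombination]
    rfl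
  rw [dualAct_apply, coe_linearCombination_nPlusD, hy, h, LinearMap.smul_apply, ← charL_eq,
    LinearMap.neg_apply, smul_eq_mul]
  ring

/-- The canonical generator of the standard Whittaker module. -/
def whittakerGenerator : StdWhittaker η :=
  Submodule.Quotient.mk (1 ⊗ₜ[ℂ] (1 : ℂ))

-- The map b ⊗ c ↦ c · (b l), with l the Whittaker functional in the dual of `TreeSp`, kills the
-- balancing relations and sends 1 ⊗ 1 to l ≠ 0.
open scoped TensorProduct in
theorem whittakerGenerator_ne_zero : whittakerGenerator η ≠ 0 := by
  obtain ⟨l, hl, h⟩ := exists_dual_whittaker η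
  let σ := UniversalEnvelopingAlgebra.lift ℂ dualAct
  have hσ : ∀ a, σ (envInclusion a) l = UniversalEnvelopingAlgebra.lift ℂ η a • l := by
    let S : Subalgebra ℂ (UniversalEnvelopingAlgebra ℂ nPlus) :=
      { carrier := {a | σ (envInclusion a) l = UniversalEnvelopingAlgebra.lift ℂ η a • l}
        mul_mem' := fun {a b} ha hb => by
          simp only [Set.mem_ofPred_eq] at ha hb ⊢
          rw [map_mul, map_mul, map_mul, Module.End.mul_apply, hb, map_smul, ha, smul_smul,
            mul_comm]
        add_mem' := fun {a b} ha hb => by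
          simp only [Set.mem_ofPred_eq] at ha hb ⊢
          rw [map_add, map_add, map_add, LinearMap.add_apply, ha, hb, add_smul]
        algebraMap_mem' := fun c => by
          simp only [Set.mem_ofPred_eq, AlgHom.commutes, Module.algebraMap_end_apply]
          rfl }
    intro a
    have : a ∈ S := by
      rw [envelope_subalgebra_eq_top S fun x => ?_]
      · trivial
      · change σ (envInclusion _) l = UniversalEnvelopingAlgebra.lift ℂ η _ • l
        rw [envInclusion, UniversalEnvelopingAlgebra.lift_ι_apply,
          UniversalEnvelopingAlgebra.lift_ι_apply, ← h x]
        exact LinearMap.congr_fun (UniversalEnvelopingAlgebra.lift_ι_apply ℂ dualAct _) l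
    exact this
  let g : UniversalEnvelopingAlgebra ℂ InsElimAlg ⊗[ℂ] ℂ →ₗ[ℂ] Module.Dual ℂ TreeSp :=
    TensorProduct.lift (((LinearMap.lsmul ℂ (Module.Dual ℂ TreeSp)).flip.comp
      (LinearMap.applyₗ l)).comp σ.toLinearMap)
  have hg : ∀ b c, g (b ⊗ₜ c) = c • σ b l := fun b c => rfl
  have hgs : ∀ u x, g (u • x) = σ u (g x) := by
    intro u x
    induction x using TensorProduct.induction_on with
    | zero => simp
    | tmul b c => rw [TensorProduct.smul_tmul', hg, hg, smul_eq_mul, map_mul, map_smul]; rfl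
    | add x y hx hy => rw [smul_add, map_add, map_add, map_add, hx, hy]
  have hker : ∀ x ∈ balancing envInclusion (oneDimAct η), g x = 0 := by
    intro x hx
    induction hx using Submodule.span_induction with
    | mem x hx =>
      obtain ⟨b, a, c, rfl⟩ := hx
      have h₁ : oneDimAct η a c = UniversalEnvelopingAlgebra.lift ℂ η a * c := rfl
      rw [map_sub, hg, hg, map_mul, Module.End.mul_apply, hσ, map_smul, h₁, smul_smul, mul_comm,
        sub_self]
    | zero => exact map_zero g
    | add x y _ _ hx hy => rw [map_add, hx, hy, add_zero]
    | smul u x _ hx => rw [hgs, hx, map_zero]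
  intro h0
  have h1 := hker _ ((Submodule.Quotient.mk_eq_zero _).1 h0)
  rw [hg, map_one, one_smul] at h1
  exact hl h1

theorem whittakerGenerator_spec (x : nPlus) :
    UniversalEnvelopingAlgebra.ι ℂ (x : InsElimAlg) • whittakerGenerator η =
      η x • whittakerGenerator η := by
  have h₁ : envInclusion (UniversalEnvelopingAlgebra.ι ℂ x) =
      UniversalEnvelopingAlgebra.ι ℂ (x : InsElimAlg) := by
    rw [envInclusion, UniversalEnvelopingAlgebra.lift_ι_apply]
    rfl
  have h₂ : oneDimAct η (UniversalEnvelopingAlgebra.ι ℂ x) 1 = η x := by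
    change UniversalEnvelopingAlgebra.lift ℂ η (UniversalEnvelopingAlgebra.ι ℂ x) * 1 = η x
    rw [UniversalEnvelopingAlgebra.lift_ι_apply, mul_one]
  rw [whittakerGenerator, ← Submodule.Quotient.mk_smul, ← Submodule.Quotient.mk_smul,
    Submodule.Quotient.eq]
  refine Submodule.subset_span ⟨1, UniversalEnvelopingAlgebra.ι ℂ x, 1, ?_⟩
  rw [h₁, h₂, one_mul, TensorProduct.smul_tmul', smul_eq_mul, mul_one, TensorProduct.smul_tmul',
    TensorProduct.smul_tmul, smul_eq_mul, mul_one]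

theorem whittakerGenerator_generates (P : Submodule ℂ (StdWhittaker η))
    (hw : whittakerGenerator η ∈ P)
    (h : ∀ x : InsElimAlg, ∀ v ∈ P, UniversalEnvelopingAlgebra.ι ℂ x • v ∈ P) : P = ⊤ := by
  rw [eq_top_iff]
  rintro v -
  obtain ⟨x, rfl⟩ := Submodule.Quotient.mk_surjective _ v
  induction x using TensorProduct.induction_on with
  | zero => exact P.zero_mem
  | add x y hx hy => exact P.add_mem hx hy
  | tmul b c =>
    have hb : b ⊗ₜ[ℂ] c = c • b • ((1 : UniversalEnvelopingAlgebra ℂ InsElimAlg) ⊗ₜ[ℂ] (1 : ℂ)) := by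
      rw [TensorProduct.smul_tmul', smul_eq_mul, mul_one, ← TensorProduct.tmul_smul, smul_eq_mul,
        mul_one]
    rw [hb]
    exact P.smul_mem c (envelope_smul_mem P h b hw)

/-- The action of the insertion-elimination algebra on the standard Whittaker module. -/
def stdAct : InsElimAlg →ₗ[ℂ] Module.End ℂ (StdWhittaker η) :=
  (Algebra.lsmul ℂ ℂ (StdWhittaker η)).toLinearMap.comp
    (UniversalEnvelopingAlgebra.ι ℂ : InsElimAlg →ₗ⁅ℂ⁆ _).toLinearMap

theorem stdAct_apply (x : InsElimAlg) (v : StdWhittaker η) :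
    stdAct η x v = UniversalEnvelopingAlgebra.ι ℂ x • v := rfl

theorem stdAct_lie (x y : InsElimAlg) :
    stdAct η ⁅x, y⁆ = stdAct η x * stdAct η y - stdAct η y * stdAct η x := by
  refine LinearMap.ext fun v => ?_
  simp only [LinearMap.sub_apply, Module.End.mul_apply, stdAct_apply, LieHom.map_lie, Ring.lie_def,
    sub_smul, mul_smul]

theorem stdAct_plus_generator (t : RTree) : stdAct η (Dplus t) (whittakerGenerator η) =
    charL η (single t 1) • whittakerGenerator η := by
  rw [charL_single]
  exact whittakerGenerator_spec η (nPlusD t)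

theorem eq_smul_whittakerGenerator (hη : η ≠ 0) (hfin : FiniteSupport η) {v : StdWhittaker η}
    (hv : ∀ t, stdAct η (Dplus t) v = charL η (single t 1) • v) :
    ∃ c : ℂ, v = c • whittakerGenerator η := by
  obtain ⟨M, -, hM⟩ := hfin
  refine eq_smul_of_whittaker (stdAct_lie η) (stdAct_plus_generator η)
    (whittakerGenerator_generates η) (whittakerGenerator_ne_zero η) ?_ ⟨M, fun t ht => ?_⟩ hv
  · simpa only [charL_single] using exists_nPlusD_ne_zero η hη
  · rw [charL_single, hM t ht]

end StdWhittaker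

end InsElim

end

/-! ### Simplicity and the dimension of the space of Whittaker vectors -/

theorem mainTheorem5 (η : LieAlgebra.LieCharacter ℂ InsElim.nPlus) (hη : η ≠ 0)
    (hfin : InsElim.FiniteSupport η) :
    IsSimpleModule (UniversalEnvelopingAlgebra ℂ InsElim.InsElimAlg) (InsElim.StdWhittaker η) ∧
      Module.finrank ℂ (InsElim.whittakerVectors η (InsElim.StdWhittaker η)) = 1 := by
  have hw0 := InsElim.whittakerGenerator_ne_zero η
  constructor
  · have : Nontrivial (InsElim.StdWhittaker η) := ⟨_, _, hw0⟩
    rw [isSimpleModule_iff]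
    refine ⟨fun N => or_iff_not_imp_left.2 fun hN => ?_⟩
    have hinv : ∀ x, ∀ v ∈ N.restrictScalars ℂ,
        InsElim.stdAct η x v ∈ N.restrictScalars ℂ := fun x v hv => N.smul_mem _ hv
    obtain ⟨v, hv, hv0, hvw⟩ := InsElim.exists_whittaker_mem (InsElim.stdAct_lie η)
      (InsElim.stdAct_plus_generator η) (InsElim.whittakerGenerator_generates η)
      (P := N.restrictScalars ℂ) (by rwa [Ne, Submodule.restrictScalars_eq_bot_iff]) hinv
    -- The Whittaker vector found in N is a nonzero multiple of the generator, so N contains the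
    -- generator.
    obtain ⟨c, rfl⟩ := InsElim.eq_smul_whittakerGenerator η hη hfin hvw
    have hc : c ≠ 0 := fun h => hv0 (by rw [h, zero_smul])
    have hw := (Submodule.smul_mem_iff _ hc).1 hv
    exact (Submodule.restrictScalars_eq_top_iff _ _ _).1
      (InsElim.whittakerGenerator_generates η _ hw hinv)
  · refine finrank_eq_one ⟨_, InsElim.whittakerGenerator_spec η⟩
      (fun h => hw0 (congrArg Subtype.val h)) ?_
    rintro ⟨v, hv⟩
    obtain ⟨c, hc⟩ := InsElim.eq_smul_whittakerGenerator η hη hfin (v := v) fun t => by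
      rw [InsElim.charL_single]
      exact hv (InsElim.nPlusD t)
    exact ⟨c, Subtype.ext hc.symm⟩
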